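/- **Setting.** Let $\mathcal X\subset\mathbb R^d$ be a finite nonempty set, and let $k:\mathcal X\times\mathcal X\to\mathbb R$ be a positive semidefinite kernel that is stationary ($k(x,x')$ depends only on $x-x'$), with $k(x,x)=1$ for all $x\in\mathcal X$. Let $f\sim\mathcal{GP}(0,k)$, i.e. $(f(x))_{x\in\mathcal X}$ is a centred Gaussian vector with covariance matrix $(k(x,x'))_{x,x'\in\mathcal X}$. Querying a point $x$ returns $y=f(x)+\epsilon$, where the noises are i.i.d. $\mathcal N(0,\sigma^2)$ with $\sigma>0$; each noise is independent of $f$, of all earlier queries and observations, and of the query at which it occurs. **Thompson sampling.** Let $\mathcal D_0$ be an initial dataset of $n_0\ge 0$ pairs (query, noisy observation), whose query points are chosen, deterministically or at random, without access to $f$ other than through earlier data. In round $t=1,2,\dots$, the algorithm draws a sample path $g_t$ from the posterior distribution of $f$ given $\mathcal D_{t-1}$ (given $\mathcal D_{t-1}$, $g_t$ is conditionally independent of $f$), queries a point $x_t\in\arg\max_{x\in\mathcal X}g_t(x)$ (ties broken by any, possibly randomized, rule based on $\mathcal D_{t-1}$ and $g_t$ only), observes $y_t=f(x_t)+\epsilon_t$,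 and adds $(x_t,y_t)$ to $\mathcal D_{t-1}$ to form $\mathcal D_t$. **Quantities.** With $x^*\in\arg\max_{x\in\mathcal X}f(x)$, the Bayesian cumulative regret is $$\mathrm{BCR}_T=\mathbb E\Big[\sum_{t=1}^T\big(f(x^*)-f(x_t)\big)\Big],$$ the expectation being over all the randomness. The maximum information gain is $$\gamma_T=\max_{(a_1,\dots,a_T)\in\mathcal X^T} I(y_A;f_A),\qquad f_A=(f(a_i))_{i=1}^T,\quad y_A=(f(a_i)+\epsilon_i)_{i=1}^T,$$ where $\epsilon_1,\dots,\epsilon_T$ are i.i.d. $\mathcal N(0,\sigma^2)$ independent of $f$, repetitions among the $a_i$ are allowed, and $I$ is the Shannon mutual information (in nats). **Theorem.** For every $T\ge 0$ the cumulative regret $\sum_{t=1}^T(f(x^*)-f(x_t))$ of Thompson sampling is integrable, and $$\mathrm{BCR}_T\le\sqrt{C_1C_2\,T\,\gamma_T},\qquad C_1=\frac{2}{\log(1+\sigma^{-2})},\qquad C_2=2+2\log\big(|\mathcal X|/2\big).$$ -/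

import Mathlib

open MeasureTheory ProbabilityTheory

noncomputable section

namespace BayesOpt

/-- A stationary kernel on a domain `D` of `ℝᵈ`: `k x x'` depends only on `x - x'`. -/
def IsStationary {d : ℕ} {D : Finset (EuclideanSpace ℝ (Fin d))} (k : D → D → ℝ) : Prop :=
  ∃ κ : EuclideanSpace ℝ (Fin d) → ℝ,
    ∀ x x' : D, k x x' = κ ((x : EuclideanSpace ℝ (Fin d)) - (x' : EuclideanSpace ℝ (Fin d)))

open Classical in
/-- The law of a sample path of the centred Gaussian process `GP(0, k)` on a finite domain `X`:
the Gaussian measure on `X → ℝ` with mean zero and covariance matrix `(k x x')`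
(for `k` positive semidefinite). -/
def gpLaw {X : Type*} [Fintype X] (k : X → X → ℝ) : Measure (X → ℝ) :=
  (multivariateGaussian (0 : EuclideanSpace ℝ X) (Matrix.of k)).map WithLp.ofLp

/-- The centred Gaussian distribution `N(0, σ²)` of one observation noise. -/
def noiseLaw (σ : ℝ) : Measure ℝ := gaussianReal 0 (Real.toNNReal (σ ^ 2))

/-- Shannon mutual information of two random variables: the Kullback-Leibler divergence of their
joint law from the product of their marginal laws. -/
def mutualInfo {Ω α β : Type*} [MeasurableSpace Ω] [MeasurableSpace α] [MeasurableSpace β]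
    (P : Measure Ω) (U : Ω → α) (V : Ω → β) : ENNReal :=
  InformationTheory.klDiv (P.map (fun ω ↦ (U ω, V ω))) ((P.map U).prod (P.map V))

/-- The information gain `I(y_A ; f_A)` of a list of query points `a₁, …, a_T` (repetitions
allowed): here `f ~ GP(0, k)`, the noises are i.i.d. `N(0, σ²)` and independent of `f`,
`f_A = (f(aᵢ))ᵢ` and `y_A = (f(aᵢ) + εᵢ)ᵢ`. -/
def infoGain {X : Type*} [Fintype X] (k : X → X → ℝ) (σ : ℝ) {T : ℕ} (a : Fin T → X) : ENNReal :=
  mutualInfo ((gpLaw k).prod (Measure.pi (fun _ : Fin T ↦ noiseLaw σ)))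
    (fun p : (X → ℝ) × (Fin T → ℝ) ↦ fun i ↦ p.1 (a i) + p.2 i)
    (fun p : (X → ℝ) × (Fin T → ℝ) ↦ fun i ↦ p.1 (a i))

/-- The maximum information gain `γ_T` of `T` noisy evaluations. -/
def maxInfoGain {X : Type*} [Fintype X] (k : X → X → ℝ) (σ : ℝ) (T : ℕ) : ℝ :=
  (⨆ a : Fin T → X, infoGain k σ a).toReal

/-- The noisy observation `f(xᵢ) + εᵢ` made at the `i`-th query. -/
def observation {Ω X : Type*} (f : Ω → X → ℝ) (ε : ℕ → Ω → ℝ) (x : ℕ → Ω → X) (i : ℕ) (ω : Ω) :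
    ℝ :=
  f ω (x i ω) + ε i ω

/-- The dataset formed by the first `n` query points and their observations. -/
def dataset {Ω X : Type*} (f : Ω → X → ℝ) (ε : ℕ → Ω → ℝ) (x : ℕ → Ω → X) (n : ℕ) (ω : Ω) :
    Fin n → X × ℝ :=
  fun i ↦ (x i ω, observation f ε x i ω)

/-- Given `(F, Z)`, the conditional law of `U` is `κ Z`: it depends on `Z` only, so that `U` is
conditionally independent of `F` given `Z`. -/
def HasCondLaw {Ω α β γ : Type*} [MeasurableSpace Ω] [MeasurableSpace α] [MeasurableSpace β]
    [MeasurableSpace γ] (U : Ω → α) (Z : Ω → β) (F : Ω → γ) (κ : Kernel β α) (P : Measure Ω) :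
    Prop :=
  HasCondDistrib U (fun ω ↦ (F ω, Z ω)) (Kernel.prodMkLeft γ κ) P

/-- `U` is drawn, possibly at random, using only the information `Z`, and not `F`. -/
def DrawnFrom {Ω α β γ : Type*} [MeasurableSpace Ω] [MeasurableSpace α] [MeasurableSpace β]
    [MeasurableSpace γ] (U : Ω → α) (Z : Ω → β) (F : Ω → γ) (P : Measure Ω) : Prop :=
  ∃ κ : Kernel β α, IsMarkovKernel κ ∧ HasCondLaw U Z F κ P

/-- A run of Thompson sampling with prior `GP(0, k)`, noise variance `σ²` and an initial dataset of
`n₀` observations. Queries are numbered from `0`: those with index `< n₀` produce the initial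
dataset, and the `t`-th round of the algorithm (`t ≥ 1`) makes the query with index `n₀ + t - 1`. -/
structure IsThompsonSampling {Ω X : Type*} [MeasurableSpace Ω] [Fintype X] [MeasurableSpace X]
    (k : X → X → ℝ) (σ : ℝ) (n₀ : ℕ) (P : Measure Ω) [IsProbabilityMeasure P]
    (f : Ω → X → ℝ) (ε : ℕ → Ω → ℝ) (g : ℕ → Ω → X → ℝ) (x : ℕ → Ω → X) : Prop where
  /-- The objective is a sample path of `GP(0, k)`. -/
  objective : HasLaw f (gpLaw k) P
  /-- Each noise has law `N(0, σ²)`. -/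
  noise_law : ∀ i, HasLaw (ε i) (noiseLaw σ) P
  /-- Each noise is independent of the objective, of all earlier queries and observations, and of
  the query at which it occurs. -/
  noise_indep : ∀ i, IndepFun (ε i) (fun ω ↦ (f ω, dataset f ε x i ω, x i ω)) P
  /-- The points of the initial dataset are chosen, deterministically or at random, without access
  to the objective other than through the data. -/
  initial : ∀ i < n₀, DrawnFrom (x i) (dataset f ε x i) f P
  /-- `g i` is a fresh sample from the posterior distribution `p(f | data)`: given the objective
  and the data, its law is the conditional law of the objective given the data. -/
  sample : ∀ i, n₀ ≤ i →
    HasCondLaw (g i) (dataset f ε x i) f (condDistrib f (dataset f ε x i) P) P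
  /-- The query maximizes the sampled path. -/
  query_max : ∀ i, n₀ ≤ i → ∀ᵐ ω ∂P, ∀ z, g i ω z ≤ g i ω (x i ω)
  /-- Ties are broken by any (possibly randomized) rule using only the data and the sample. -/
  query_rule : ∀ i, n₀ ≤ i → DrawnFrom (x i) (fun ω ↦ (dataset f ε x i ω, g i ω)) f P

/-- The cumulative regret `∑_{t=1}^T (f(x*) - f(x_t))` of the `T` queries after the initial ones,
where `f(x*)` is the maximum of `f`. -/
def cumulativeRegret {Ω X : Type*} (f : Ω → X → ℝ) (x : ℕ → Ω → X) (n₀ T : ℕ) (ω : Ω) : ℝ :=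
  ∑ t ∈ Finset.range T, ((⨆ z, f ω z) - f ω (x (n₀ + t) ω))

/-- The Bayesian cumulative regret `BCR_T`. -/
def bayesCumulativeRegret {Ω X : Type*} [MeasurableSpace Ω] (P : Measure Ω) (f : Ω → X → ℝ)
    (x : ℕ → Ω → X) (n₀ T : ℕ) : ℝ :=
  ∫ ω, cumulativeRegret f x n₀ T ω ∂P

end BayesOpt

end

/-! Given the first `n` observations, the objective is Gaussian with mean `postMean` and covariance
`postCov`, although the queries are adaptive: a query drawn from the data alone carries no further
information on `f` (`hasCondDistrib_residual`). The sample `g n` has the same joint law with the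
data as `f`. Hence `max f` and `max (g n) = g n (x n)` have the same mean, while `f (x n)` and the
posterior mean at `x n` have the same mean because `x n` and `f` are conditionally independent. The
expected regret of a round is therefore the mean of `g n - postMean` at the random point `x n`.

Given the data, this difference is a centred Gaussian vector. Its value at `x n` is at most the
largest standardized score times the posterior standard deviation at `x n`. By Cauchy-Schwarz, the
regret is at most the square root of the second moment of that score, bounded by `C₂` through
Gaussian tails (`lintegral_maxScore_sq_le`), times the mean posterior variance at `x n`
(`integral_eval_le_sqrt`).

A second use of Cauchy-Schwarz, over the rounds, leaves the sum of the posterior variances. By the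
chain rule, the information gain of fixed points is the sum of `log (1 + variance / σ²) / 2`
(`infoGain_eq`). Since variances are at most 1, concavity of the logarithm compares them linearly
with these terms, whence `C₁`. The initial observations only lower the variances, so they may be
forgotten, leaving exactly `T` points (`sum_postCov_le`). -/

open MeasureTheory ProbabilityTheory

namespace BayesOpt

/-! ### Posterior covariance as a quadratic form: positivity and monotonicity -/

section PosteriorCovariance

variable {X : Type*}

lemma symm_of_posSemidef {C : X → X → ℝ} (hC : (Matrix.of C).PosSemidef) (x y : X) :
    C x y = C y x := by
  simpa using (hC.isHermitian.apply x y).symm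

lemma diag_nonneg {C : X → X → ℝ} (hC : (Matrix.of C).PosSemidef) (x : X) : 0 ≤ C x x :=
  hC.diag_nonneg (i := x)

variable [Fintype X]

/-- The quadratic form of a kernel. -/
def quadForm (C : X → X → ℝ) (t : X → ℝ) : ℝ := ∑ x, ∑ y, t x * t y * C x y

lemma dotProduct_mulVec_eq_quadForm (C : X → X → ℝ) (t : X → ℝ) :
    t ⬝ᵥ (Matrix.of C).mulVec t = quadForm C t := by
  simp only [dotProduct, Matrix.mulVec, quadForm, Matrix.of_apply, Finset.mul_sum]
  exact Finset.sum_congr rfl fun x _ ↦ Finset.sum_congr rfl fun y _ ↦ by ring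

lemma quadForm_nonneg {C : X → X → ℝ} (hC : (Matrix.of C).PosSemidef) (t : X → ℝ) :
    0 ≤ quadForm C t := by
  rw [← dotProduct_mulVec_eq_quadForm]
  simpa using hC.dotProduct_mulVec_nonneg t

lemma posSemidef_of_quadForm_nonneg {C : X → X → ℝ} (hs : ∀ x y, C x y = C y x)
    (h : ∀ t, 0 ≤ quadForm C t) : (Matrix.of C).PosSemidef := by
  refine .of_dotProduct_mulVec_nonneg ?_ fun t ↦ ?_
  · ext x y
    simp [hs x y]
  · simpa [dotProduct_mulVec_eq_quadForm] using h t

open Classical in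
lemma quadForm_single (C : X → X → ℝ) (a : X) (b : ℝ) :
    quadForm C (Pi.single a b) = b ^ 2 * C a a := by
  simp [quadForm, Pi.single_apply, ite_mul, mul_ite, sq]

open Classical in
lemma quadForm_add_single {C : X → X → ℝ} (hs : ∀ x y, C x y = C y x) (t : X → ℝ) (a : X)
    (b : ℝ) :
    quadForm C (t + Pi.single a b) = quadForm C t + 2 * b * ∑ x, t x * C x a + b ^ 2 * C a a := by
  have h (x y : X) : (t + Pi.single a b : X → ℝ) x * (t + Pi.single a b : X → ℝ) y * C x y =
      t x * t y * C x y + (Pi.single a b : X → ℝ) y * (t x * C x y)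
        + (Pi.single a b : X → ℝ) x * (t y * C y x)
        + (Pi.single a b : X → ℝ) x * ((Pi.single a b : X → ℝ) y * C x y) := by
    rw [Pi.add_apply, Pi.add_apply, hs y x]; ring
  simp only [quadForm, h, Finset.sum_add_distrib, ← Finset.mul_sum]
  simp only [Pi.single_apply, ite_mul, zero_mul, Finset.sum_ite_eq', Finset.mem_univ, if_true,
    ← Finset.mul_sum]
  ring

/-- The covariance kernel of `GP(0, C)` after one observation at `a` with noise variance `σ²`. -/
noncomputable def condCov (σ : ℝ) (C : X → X → ℝ) (a : X) : X → X → ℝ :=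
  fun x y ↦ C x y - C x a * C y a / (C a a + σ ^ 2)

lemma quadForm_condCov (σ : ℝ) (C : X → X → ℝ) (a : X) (t : X → ℝ) :
    quadForm (condCov σ C a) t = quadForm C t - (∑ x, t x * C x a) ^ 2 / (C a a + σ ^ 2) := by
  simp only [quadForm, condCov, mul_sub, Finset.sum_sub_distrib]
  congr 1
  rw [sq (∑ x, _), Finset.sum_mul_sum, Finset.sum_div]
  refine Finset.sum_congr rfl fun x _ ↦ ?_
  rw [Finset.sum_div]
  exact Finset.sum_congr rfl fun y _ ↦ by ring

-- Completing the square in `b`. Minimizing the right side over `b` shows that the conditional form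
-- at `t` is the minimum of `quadForm C (t + b eₐ) + b² σ²`. Positivity and monotonicity of
-- conditioning both follow from this, and the same identity matches the exponents in
-- `map_observation_residual`.
open Classical in
lemma quadForm_condCov_add {σ : ℝ} (hσ : 0 < σ) {C : X → X → ℝ} (hC : (Matrix.of C).PosSemidef)
    (a : X) (t : X → ℝ) (b : ℝ) :
    quadForm (condCov σ C a) t +
        (C a a + σ ^ 2) * (b + (∑ x, t x * C x a) / (C a a + σ ^ 2)) ^ 2 =
      quadForm C (t + Pi.single a b) + b ^ 2 * σ ^ 2 := by
  have hv : C a a + σ ^ 2 ≠ 0 := by have := diag_nonneg hC a; positivity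
  rw [quadForm_condCov, quadForm_add_single (symm_of_posSemidef hC)]
  field_simp
  ring

lemma condCov_posSemidef {σ : ℝ} (hσ : 0 < σ) {C : X → X → ℝ} (hC : (Matrix.of C).PosSemidef)
    (a : X) : (Matrix.of (condCov σ C a)).PosSemidef := by
  classical
  refine posSemidef_of_quadForm_nonneg (fun x y ↦ ?_) fun t ↦ ?_
  · simp only [condCov, symm_of_posSemidef hC x y]
    ring
  · have h := quadForm_condCov_add hσ hC a t (-((∑ x, t x * C x a) / (C a a + σ ^ 2)))
    rw [neg_add_cancel, zero_pow two_ne_zero, mul_zero, add_zero] at h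
    rw [h]
    have := quadForm_nonneg hC (t + Pi.single a (-((∑ x, t x * C x a) / (C a a + σ ^ 2))))
    positivity

lemma condCov_le {σ : ℝ} (hσ : 0 < σ) {C : X → X → ℝ} (hC : (Matrix.of C).PosSemidef)
    (a : X) (t : X → ℝ) : quadForm (condCov σ C a) t ≤ quadForm C t := by
  rw [quadForm_condCov]
  have := diag_nonneg hC a
  have : 0 ≤ (∑ x, t x * C x a) ^ 2 / (C a a + σ ^ 2) := by positivity
  linarith

/-- Conditional forms are minima over `b`, and minima respect order. It suffices to insert the
minimizer for `C'` into the expression for `C`. -/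
lemma condCov_mono {σ : ℝ} (hσ : 0 < σ) {C C' : X → X → ℝ} (hC : (Matrix.of C).PosSemidef)
    (hC' : (Matrix.of C').PosSemidef) (h : ∀ t, quadForm C t ≤ quadForm C' t)
    (a : X) (t : X → ℝ) : quadForm (condCov σ C a) t ≤ quadForm (condCov σ C' a) t := by
  classical
  set b := -((∑ x, t x * C' x a) / (C' a a + σ ^ 2)) with hb
  have h1 := quadForm_condCov_add hσ hC a t b
  have h2 := quadForm_condCov_add hσ hC' a t b
  rw [hb, neg_add_cancel, zero_pow two_ne_zero, mul_zero, add_zero, ← hb] at h2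
  have h3 := h (t + Pi.single a b)
  have := diag_nonneg hC a
  have h4 : 0 ≤ (C a a + σ ^ 2) * (b + (∑ x, t x * C x a) / (C a a + σ ^ 2)) ^ 2 := by positivity
  linarith

/-- The covariance kernel of `GP(0, k)` given `n` noisy observations at the points `a`. -/
noncomputable def postCov (σ : ℝ) (k : X → X → ℝ) : (n : ℕ) → (Fin n → X) → X → X → ℝ
  | 0, _ => k
  | n + 1, a => condCov σ (postCov σ k n (Fin.init a)) (a (Fin.last n))

lemma postCov_posSemidef {σ : ℝ} (hσ : 0 < σ) {k : X → X → ℝ} (hk : (Matrix.of k).PosSemidef) :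
    ∀ (n : ℕ) (a : Fin n → X), (Matrix.of (postCov σ k n a)).PosSemidef
  | 0, _ => hk
  | n + 1, _ => condCov_posSemidef hσ (postCov_posSemidef hσ hk n _) _

/-- Discarding the first `m` observations increases the posterior covariance. -/
lemma postCov_add_le {σ : ℝ} (hσ : 0 < σ) {k : X → X → ℝ} (hk : (Matrix.of k).PosSemidef)
    (m : ℕ) (a : ℕ → X) (n : ℕ) (t : X → ℝ) :
    quadForm (postCov σ k (m + n) fun i ↦ a i) t ≤
      quadForm (postCov σ k n fun i ↦ a (m + i)) t := by
  induction n generalizing t with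
  | zero =>
    -- Without later observations, the `m` early ones are removed one at a time by `condCov_le`.
    -- Later observations preserve the inequality by `condCov_mono`.
    induction m with
    | zero => exact le_rfl
    | succ m ih => exact (condCov_le hσ (postCov_posSemidef hσ hk m _) _ t).trans ih
  | succ n ih =>
    exact condCov_mono hσ (postCov_posSemidef hσ hk _ _) (postCov_posSemidef hσ hk _ _) ih _ t

lemma diag_le_of_quadForm_le {C C' : X → X → ℝ} (h : ∀ t, quadForm C t ≤ quadForm C' t) (x : X) :
    C x x ≤ C' x x := by
  classical
  simpa [quadForm_single] using h (Pi.single x 1)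

lemma postCov_diag_le {σ : ℝ} (hσ : 0 < σ) {k : X → X → ℝ} (hk : (Matrix.of k).PosSemidef) :
    ∀ (n : ℕ) (a : Fin n → X) (x : X), postCov σ k n a x x ≤ k x x
  | 0, _, _ => le_rfl
  | n + 1, _, x => (diag_le_of_quadForm_le (condCov_le hσ (postCov_posSemidef hσ hk n _) _) x).trans
      (postCov_diag_le hσ hk n _ x)

end PosteriorCovariance

/-! ### Gaussian vectors and one step of Bayesian updating -/

section GaussianLaw

variable {X : Type*} [Fintype X]

instance (k : X → X → ℝ) : IsProbabilityMeasure (gpLaw k) :=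
  Measure.isProbabilityMeasure_map (by fun_prop)

instance (σ : ℝ) : IsProbabilityMeasure (noiseLaw σ) := by
  unfold noiseLaw; infer_instance

open Classical in
lemma charFunDual_gpLaw {C : X → X → ℝ} (hC : (Matrix.of C).PosSemidef)
    (l : StrongDual ℝ (X → ℝ)) :
    charFunDual (gpLaw C) l = Complex.exp (-(quadForm C fun x ↦ l (Pi.single x 1)) / 2) := by
  have hl (v : X → ℝ) : l v = ∑ x, v x * l (Pi.single x 1) := by
    conv_lhs => rw [pi_eq_sum_univ' v]
    simp [map_sum]
  rw [charFunDual_apply, gpLaw, integral_map (by fun_prop) (by fun_prop)]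
  have h := charFun_multivariateGaussian (μ := 0) hC
    (WithLp.toLp 2 fun x ↦ l (Pi.single x 1) : EuclideanSpace ℝ X)
  rw [charFun_apply] at h
  convert! h using 1
  · congr with v
    rw [hl, PiLp.inner_apply]
    simp [mul_comm]
  · simp [← dotProduct_mulVec_eq_quadForm, neg_div]

lemma map_eval_gpLaw {C : X → X → ℝ} (hC : (Matrix.of C).PosSemidef) (x : X) :
    (gpLaw C).map (fun r ↦ r x) = gaussianReal 0 (C x x).toNNReal := by
  classical
  rw [gpLaw, Measure.map_map (by fun_prop) (by fun_prop)]
  exact (measurePreserving_eval_multivariateGaussian (μ := 0) hC (i := x)).map_eq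

/-- Bayesian updating of a Gaussian process: the observation at `a` and the residual of the process
after linear prediction from this observation are independent Gaussians. -/
lemma map_observation_residual {σ : ℝ} (hσ : 0 < σ) {C : X → X → ℝ}
    (hC : (Matrix.of C).PosSemidef) (a : X) :
    ((gpLaw C).prod (noiseLaw σ)).map
        (fun p ↦ (p.1 a + p.2, fun x ↦ p.1 x - C x a / (C a a + σ ^ 2) * (p.1 a + p.2))) =
      (gaussianReal 0 (C a a + σ ^ 2).toNNReal).prod (gpLaw (condCov σ C a)) := by
  classical
  have hv : C a a + σ ^ 2 ≠ 0 := by have := diag_nonneg hC a; positivity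
  let E : (X → ℝ) × ℝ →L[ℝ] ℝ :=
    (ContinuousLinearMap.proj (R := ℝ) (φ := fun _ : X ↦ ℝ) a).comp
      (ContinuousLinearMap.fst ℝ (X → ℝ) ℝ) + ContinuousLinearMap.snd ℝ (X → ℝ) ℝ
  let Φ : (X → ℝ) × ℝ →L[ℝ] ℝ × (X → ℝ) :=
    E.prod (ContinuousLinearMap.fst ℝ (X → ℝ) ℝ -
      E.smulRight (fun x ↦ C x a / (C a a + σ ^ 2)))
  have hΦ : (fun p : (X → ℝ) × ℝ ↦
      (p.1 a + p.2, fun x ↦ p.1 x - C x a / (C a a + σ ^ 2) * (p.1 a + p.2))) = Φ := by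
    ext p
    · simp [Φ, E]
    · simp [Φ, E, mul_comm]
  rw [hΦ]
  -- Equality of characteristic functionals gives both marginal laws and the independence at once.
  refine Measure.ext_of_charFunDual ?_
  ext l
  have hl2 (u : X → ℝ) : l (0, u) = ∑ x, u x * l (0, Pi.single x 1) := by
    have : l (0, u) = (l.comp (.inr ℝ ℝ (X → ℝ))) u := by simp
    rw [this]
    conv_lhs => rw [pi_eq_sum_univ' u]
    simp [map_sum]
  have hl1 (b : ℝ) : l (b, 0) = b * l (1, 0) := by
    have : ((b, 0) : ℝ × (X → ℝ)) = b • (1, 0) := by simp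
    rw [this, map_smul, smul_eq_mul]
  have hsplit (b : ℝ) (u : X → ℝ) : l (b, u) = l (b, 0) + l (0, u) := by
    rw [← map_add]; simp
  set α : ℝ := l (1, 0) with hα
  set t : X → ℝ := fun x ↦ l (0, Pi.single x 1) with ht
  set τ : ℝ := (∑ x, t x * C x a) / (C a a + σ ^ 2) with hτ
  have hΦl (p : (X → ℝ) × ℝ) : l (Φ p) = (α - τ) * (p.1 a + p.2) + ∑ x, p.1 x * t x := by
    rw [← hΦ, hsplit, hl1, hl2, hτ, Finset.sum_div, sub_mul, Finset.sum_mul, mul_comm _ α]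
    have : ∀ x, (p.1 x - C x a / (C a a + σ ^ 2) * (p.1 a + p.2)) * l (0, Pi.single x 1) =
        p.1 x * t x - t x * C x a / (C a a + σ ^ 2) * (p.1 a + p.2) := fun x ↦ by
      simp only [ht]; ring
    simp only [this, Finset.sum_sub_distrib]
    ring
  rw [charFunDual_map, charFunDual_prod, charFunDual_prod, charFunDual_gpLaw hC,
    charFunDual_gpLaw (condCov_posSemidef hσ hC a), noiseLaw, charFunDual_eq_charFun_map_one,
    charFunDual_eq_charFun_map_one, gaussianReal_map_continuousLinearMap,
    gaussianReal_map_continuousLinearMap, charFun_gaussianReal, charFun_gaussianReal,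
    ← Complex.exp_add, ← Complex.exp_add]
  have e1 : (fun x ↦ ((l.comp Φ).comp (.inl ℝ (X → ℝ) ℝ)) (Pi.single x 1)) =
      t + Pi.single a (α - τ) := by
    ext x
    simp only [ContinuousLinearMap.comp_apply, ContinuousLinearMap.inl_apply, hΦl, Pi.add_apply]
    by_cases hx : x = a
    · subst hx; simp [Pi.single_apply]; ring
    · simp [Pi.single_apply, hx, Ne.symm hx]
  have e2 : ((l.comp Φ).comp (.inr ℝ (X → ℝ) ℝ)) 1 = α - τ := by
    simp [hΦl]
  have e3 : (fun x ↦ (l.comp (.inr ℝ ℝ (X → ℝ))) (Pi.single x 1)) = t := by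
    ext x; simp [ht]
  have e4 : (l.comp (.inl ℝ ℝ (X → ℝ))) 1 = α := by simp [hα]
  rw [e1, e2, e3, e4]
  -- With `b = α - τ`, the completed square becomes `(C a a + σ²) α²`, the exponent of the
  -- observation. The remaining term is the exponent of the residual.
  have key := quadForm_condCov_add hσ hC a t (α - τ)
  rw [← hτ, sub_add_cancel] at key
  have hv0 : 0 ≤ C a a + σ ^ 2 := by have := diag_nonneg hC a; positivity
  simp only [NNReal.coe_mul, Real.coe_toNNReal _ (sq_nonneg _), Real.coe_toNNReal _ hv0, map_zero]
  congr 1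
  have key' := congrArg (fun r : ℝ ↦ (r : ℂ)) key
  push_cast at key' ⊢
  linear_combination (-1/2 : ℂ) * (-key')

end GaussianLaw

/-! ### Conditional laws and conditional independence -/

section ConditionalLaws

variable {Ω α β γ δ : Type*} [MeasurableSpace Ω] [MeasurableSpace α] [MeasurableSpace β]
  [MeasurableSpace γ] [MeasurableSpace δ] {P : Measure Ω} [IsProbabilityMeasure P]

/-- If `U` is drawn from `Z` only, then `R` and `U` are conditionally independent given `Z`. -/
lemma HasCondLaw.hasCondDistrib_prod {R : Ω → α} {Z : Ω → β} {U : Ω → γ} {κ : Kernel β α}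
    {η : Kernel β γ} [IsMarkovKernel κ] [IsMarkovKernel η]
    (hU : HasCondLaw U Z R η P) (hR : HasCondDistrib R Z κ P) :
    HasCondDistrib (fun ω ↦ (R ω, U ω)) Z (κ ×ₖ η) P := by
  have hRm := hR.aemeasurable_snd
  have hZm := hR.aemeasurable_fst
  have hUm := HasCondDistrib.aemeasurable_snd hU
  refine ⟨by fun_prop, ?_⟩
  have h1 : P.map (fun ω ↦ (Z ω, R ω, U ω)) =
      (P.map fun ω ↦ ((R ω, Z ω), U ω)).map (fun q ↦ (q.1.2, q.1.1, q.2)) := by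
    rw [AEMeasurable.map_map_of_aemeasurable (by fun_prop) (by fun_prop)]; rfl
  have h2 : P.map (fun ω ↦ (R ω, Z ω)) = (P.map fun ω ↦ (Z ω, R ω)).map Prod.swap := by
    rw [AEMeasurable.map_map_of_aemeasurable (by fun_prop) (by fun_prop)]; rfl
  have hm : Measurable fun q : (α × β) × γ ↦ (q.1.2, q.1.1, q.2) := by fun_prop
  ext s hs
  rw [h1, Measure.map_apply hm hs, hU.map_eq, Measure.compProd_apply (hm hs), h2, hR.map_eq,
    lintegral_map (Kernel.measurable_kernel_prodMk_left (hm hs)) measurable_swap]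
  refine (Measure.lintegral_compProd
    ((Kernel.measurable_kernel_prodMk_left (hm hs)).comp measurable_swap)).trans ?_
  rw [Measure.compProd_apply hs]
  refine lintegral_congr fun z ↦ ?_
  rw [Kernel.prod_apply, Measure.prod_apply (measurable_prodMk_left hs)]
  rfl

lemma _root_.ProbabilityTheory.HasCondDistrib.of_prod {R : Ω → α} {Z : Ω → β} {U : Ω → γ}
    {κ : Kernel β α} {η : Kernel β γ} [IsMarkovKernel κ] [IsMarkovKernel η]
    (h : HasCondDistrib (fun ω ↦ (R ω, U ω)) Z (κ ×ₖ η) P) :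
    HasCondDistrib U (fun ω ↦ (Z ω, R ω)) (Kernel.prodMkRight α η) P := by
  refine HasCondDistrib.of_compProd (κ := κ) ?_
  convert! h using 1
  ext z s hs
  rw [Kernel.prod_apply, Kernel.compProd_apply hs, Measure.prod_apply hs]
  rfl

lemma _root_.ProbabilityTheory.HasCondDistrib.swap {R : Ω → α} {Z : Ω → β} {U : Ω → γ}
    {κ : Kernel β α} {η : Kernel β γ} [IsMarkovKernel κ] [IsMarkovKernel η]
    (h : HasCondDistrib (fun ω ↦ (R ω, U ω)) Z (κ ×ₖ η) P) :
    HasCondDistrib (fun ω ↦ (U ω, R ω)) Z (η ×ₖ κ) P := by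
  rw [← Kernel.map_prod_swap]
  exact h.comp_left measurable_swap

/-- Conditional independence is symmetric: given `Z` the pair has a product law, so the roles of `R`
and `U` can be exchanged. -/
lemma HasCondLaw.hasCondDistrib_residual {R : Ω → α} {Z : Ω → β} {U : Ω → γ} {κ : Kernel β α}
    {η : Kernel β γ} [IsMarkovKernel κ] [IsMarkovKernel η]
    (hU : HasCondLaw U Z R η P) (hR : HasCondDistrib R Z κ P) :
    HasCondDistrib R (fun ω ↦ (Z ω, U ω)) (Kernel.prodMkRight γ κ) P :=
  (hU.hasCondDistrib_prod hR).swap.of_prod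

lemma HasCondLaw.hasCondDistrib {F : Ω → α} {Z : Ω → β} {U : Ω → γ} {η : Kernel β γ}
    [IsMarkovKernel η] (hU : HasCondLaw U Z F η P) : HasCondDistrib U Z η P :=
  HasCondDistrib.comp_right (f := Prod.snd) (hf := measurable_snd) hU

lemma HasCondLaw.comp_left {F : Ω → α} {Z : Ω → β} {U : Ω → γ} {η : Kernel β γ}
    [IsMarkovKernel η] (hU : HasCondLaw U Z F η P) {φ : α × β → δ} (hφ : Measurable φ) :
    HasCondLaw U Z (fun ω ↦ φ (F ω, Z ω)) η P :=
  HasCondDistrib.comp_right (f := fun p : α × β ↦ (φ p, p.2)) (hf := by fun_prop)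
    (κ := Kernel.prodMkLeft δ η) hU

lemma HasCondLaw.of_indepFun {ξ : Measure γ} [IsProbabilityMeasure ξ] {F : Ω → α} {Z : Ω → β}
    {U : Ω → γ} (hU : HasLaw U ξ P) (hF : AEMeasurable F P) (hZ : AEMeasurable Z P)
    (h : IndepFun U (fun ω ↦ (F ω, Z ω)) P) : HasCondLaw U Z F (Kernel.const β ξ) P := by
  have hUm := hU.aemeasurable
  refine ⟨by fun_prop, ?_⟩
  rw [(indepFun_iff_map_prod_eq_prod_map_map (by fun_prop) hUm).1 h.symm, hU.map_eq,
    ← Measure.compProd_const]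
  rfl

/-- Transformation of a conditional law by a function which may depend on the conditioning
variable. -/
lemma _root_.ProbabilityTheory.HasCondDistrib.map_prodMk {Y : Ω → α} {Z : Ω → β} {κ : Kernel β α} [IsMarkovKernel κ]
    (h : HasCondDistrib Y Z κ P) {Φ : β × α → γ} (hΦ : Measurable Φ) {η : Kernel β γ}
    [IsMarkovKernel η] (hη : ∀ z, (κ z).map (fun y ↦ Φ (z, y)) = η z) :
    HasCondDistrib (fun ω ↦ Φ (Z ω, Y ω)) Z η P := by
  have hYm := h.aemeasurable_snd
  have hZm := h.aemeasurable_fst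
  have hm : Measurable fun p : β × α ↦ (p.1, Φ p) := by fun_prop
  refine ⟨by fun_prop, ?_⟩
  have h1 : P.map (fun ω ↦ (Z ω, Φ (Z ω, Y ω))) =
      (P.map fun ω ↦ (Z ω, Y ω)).map fun p ↦ (p.1, Φ p) := by
    rw [AEMeasurable.map_map_of_aemeasurable (by fun_prop) (by fun_prop)]; rfl
  ext s hs
  rw [h1, h.map_eq, Measure.map_apply hm hs, Measure.compProd_apply (hm hs),
    Measure.compProd_apply hs]
  refine lintegral_congr fun z ↦ ?_
  rw [← hη, Measure.map_apply (by fun_prop) (measurable_prodMk_left hs)]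
  rfl

/-- Two successive draws which do not use `F`. -/
lemma HasCondLaw.drawnFrom_of_drawnFrom {F : Ω → α} {Z : Ω → β} {G : Ω → γ} {U : Ω → δ}
    {κ : Kernel β γ} [IsMarkovKernel κ] (hG : HasCondLaw G Z F κ P)
    (hU : DrawnFrom U (fun ω ↦ (Z ω, G ω)) F P) : DrawnFrom U Z F P := by
  obtain ⟨η, hη, hU⟩ := hU
  refine ⟨(κ ⊗ₖ η).snd, inferInstance, ?_⟩
  have hGm := HasCondDistrib.aemeasurable_snd hG
  have hFZ := HasCondDistrib.aemeasurable_fst hG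
  have hUm := HasCondDistrib.aemeasurable_snd hU
  have hF : AEMeasurable F P := hFZ.fst
  have hZ : AEMeasurable Z P := hFZ.snd
  refine ⟨by fun_prop, ?_⟩
  have h1 : P.map (fun ω ↦ ((F ω, Z ω), U ω)) =
      (P.map fun ω ↦ ((F ω, Z ω, G ω), U ω)).map fun p ↦ ((p.1.1, p.1.2.1), p.2) := by
    rw [AEMeasurable.map_map_of_aemeasurable (by fun_prop) (by fun_prop)]; rfl
  have h2 : P.map (fun ω ↦ (F ω, Z ω, G ω)) =
      (P.map fun ω ↦ ((F ω, Z ω), G ω)).map fun p ↦ (p.1.1, p.1.2, p.2) := by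
    rw [AEMeasurable.map_map_of_aemeasurable (by fun_prop) (by fun_prop)]; rfl
  have hm : Measurable fun p : (α × β × γ) × δ ↦ ((p.1.1, p.1.2.1), p.2) := by fun_prop
  have hm' : Measurable fun p : (α × β) × γ ↦ (p.1.1, p.1.2, p.2) := by fun_prop
  ext s hs
  rw [h1, Measure.map_apply hm hs, hU.map_eq, Measure.compProd_apply (hm hs), h2,
    lintegral_map (Kernel.measurable_kernel_prodMk_left (hm hs)) hm', hG.map_eq]
  refine (Measure.lintegral_compProd
    ((Kernel.measurable_kernel_prodMk_left (hm hs)).comp hm')).trans ?_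
  rw [Measure.compProd_apply hs]
  refine lintegral_congr fun z ↦ ?_
  rw [Kernel.prodMkLeft_apply κ, Kernel.prodMkLeft_apply (κ ⊗ₖ η).snd, Kernel.snd_apply,
    Measure.map_apply measurable_snd (measurable_prodMk_left hs),
    Kernel.compProd_apply (measurable_snd (measurable_prodMk_left hs))]
  rfl

end ConditionalLaws

/-! ### The posterior under adaptive queries -/

section Residual

variable {X : Type*}

/-- The posterior mean of `GP(0, k)` given a dataset of `n` noisy observations. -/
noncomputable def postMean (σ : ℝ) (k : X → X → ℝ) : (n : ℕ) → (Fin n → X × ℝ) → X → ℝ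
  | 0, _ => 0
  | n + 1, d => fun x ↦
    let a := (d (Fin.last n)).1
    let C := postCov σ k n fun i ↦ (d i.castSucc).1
    postMean σ k n (Fin.init d) x +
      C x a / (C a a + σ ^ 2) * ((d (Fin.last n)).2 - postMean σ k n (Fin.init d) a)

/-- The query points of a dataset. -/
def queries (n : ℕ) (d : Fin n → X × ℝ) : Fin n → X := fun i ↦ (d i).1

/-- The dataset obtained from `d` by adding the query `z` with prediction error `e`. -/
noncomputable def extendDataset (σ : ℝ) (k : X → X → ℝ) (n : ℕ)
    (q : ((Fin n → X × ℝ) × X) × ℝ) : Fin (n + 1) → X × ℝ :=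
  Fin.snoc (α := fun _ ↦ X × ℝ) q.1.1 (q.1.2, postMean σ k n q.1.1 q.1.2 + q.2)

lemma queries_extendDataset (σ : ℝ) (k : X → X → ℝ) (n : ℕ)
    (q : ((Fin n → X × ℝ) × X) × ℝ) :
    queries (n + 1) (extendDataset σ k n q) =
      Fin.snoc (α := fun _ ↦ X) (queries n q.1.1) q.1.2 := by
  ext i
  refine Fin.lastCases ?_ (fun i ↦ ?_) i <;> simp [queries, extendDataset]

lemma postCov_snoc (σ : ℝ) (k : X → X → ℝ) (n : ℕ) (a : Fin n → X) (z : X) :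
    postCov σ k (n + 1) (Fin.snoc (α := fun _ ↦ X) a z) = condCov σ (postCov σ k n a) z := by
  simp [postCov]

/-- The difference between the objective and its posterior mean given the first `n`
observations. -/
noncomputable def residual {Ω : Type*} (σ : ℝ) (k : X → X → ℝ) (f : Ω → X → ℝ) (ε : ℕ → Ω → ℝ)
    (x : ℕ → Ω → X) (n : ℕ) (ω : Ω) : X → ℝ :=
  f ω - postMean σ k n (dataset f ε x n ω)

/-- The new observation is recoded by its prediction error. Given the data and the query, this error
is independent of the next residual, which lets the induction on `n` close. -/
lemma dataset_succ {Ω : Type*} (σ : ℝ) (k : X → X → ℝ) (f : Ω → X → ℝ) (ε : ℕ → Ω → ℝ)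
    (x : ℕ → Ω → X) (n : ℕ) (ω : Ω) :
    dataset f ε x (n + 1) ω = extendDataset σ k n
      ((dataset f ε x n ω, x n ω), residual σ k f ε x n ω (x n ω) + ε n ω) := by
  ext i : 1
  refine Fin.lastCases ?_ (fun i ↦ ?_) i
  · simp only [dataset, extendDataset, residual, observation, Fin.val_last, Fin.snoc_last,
      Pi.sub_apply]
    congr 1
    ring
  · simp [dataset, extendDataset]

lemma residual_succ {Ω : Type*} (σ : ℝ) (k : X → X → ℝ) (f : Ω → X → ℝ) (ε : ℕ → Ω → ℝ)
    (x : ℕ → Ω → X) (n : ℕ) (ω : Ω) (z : X) :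
    residual σ k f ε x (n + 1) ω z = residual σ k f ε x n ω z -
      postCov σ k n (queries n (dataset f ε x n ω)) z (x n ω) /
        (postCov σ k n (queries n (dataset f ε x n ω)) (x n ω) (x n ω) + σ ^ 2) *
        (residual σ k f ε x n ω (x n ω) + ε n ω) := by
  have h1 : Fin.init (dataset f ε x (n + 1) ω) = dataset f ε x n ω := rfl
  have h2 : (fun i : Fin n ↦ (dataset f ε x (n + 1) ω i.castSucc).1) =
    queries n (dataset f ε x n ω) := rfl
  have h3 : (dataset f ε x (n + 1) ω (Fin.last n)) = (x n ω, f ω (x n ω) + ε n ω) := rfl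
  simp only [residual, postMean, Pi.sub_apply, h1, h2, h3]
  ring

variable [MeasurableSpace X]

lemma measurable_queries (n : ℕ) : Measurable (queries (X := X) n) := by
  unfold queries; fun_prop

variable [Fintype X] [MeasurableSingletonClass X]

lemma measurable_eval_point {α : Type*} [MeasurableSpace α] {u : α → X → ℝ} (hu : Measurable u)
    {a : α → X} (ha : Measurable a) : Measurable fun z ↦ u z (a z) := by
  have : Measurable fun p : (X → ℝ) × X ↦ p.1 p.2 :=
    measurable_from_prod_countable_left fun x ↦ measurable_pi_apply x
  exact this.comp (hu.prodMk ha)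

lemma measurable_postMean (σ : ℝ) (k : X → X → ℝ) (n : ℕ) : Measurable (postMean σ k n) := by
  induction n with
  | zero => exact measurable_const
  | succ n ih =>
    have hinit : Measurable fun d : Fin (n + 1) → X × ℝ ↦ Fin.init d :=
      measurable_pi_lambda _ fun i ↦ measurable_pi_apply _
    have hm : Measurable fun d : Fin (n + 1) → X × ℝ ↦ postMean σ k n (Fin.init d) :=
      ih.comp hinit
    refine measurable_pi_lambda _ fun x ↦ ?_
    simp only [postMean]
    have hq : Measurable fun d : Fin (n + 1) → X × ℝ ↦
        ((fun i : Fin n ↦ (d i.castSucc).1), (d (Fin.last n)).1) := by fun_prop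
    have hc : Measurable fun q : (Fin n → X) × X ↦
        postCov σ k n q.1 x q.2 / (postCov σ k n q.1 q.2 q.2 + σ ^ 2) := .of_discrete
    have h1 := measurable_eval_point hm
      (a := fun d ↦ (d (Fin.last n)).1) (measurable_fst.comp (measurable_pi_apply _))
    have h2 := (measurable_pi_iff.1 hm) x
    have h3 := hc.comp hq
    simp only [Function.comp_def] at h3
    fun_prop

/-- The law of the residual of `GP(0, k)` given observations at the points `a`. -/
noncomputable def postKernel (σ : ℝ) (k : X → X → ℝ) (n : ℕ) : Kernel (Fin n → X) (X → ℝ) :=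
  Kernel.ofFunOfCountable fun a ↦ gpLaw (postCov σ k n a)

instance (σ : ℝ) (k : X → X → ℝ) (n : ℕ) : IsMarkovKernel (postKernel σ k n) :=
  ⟨fun a ↦ inferInstanceAs (IsProbabilityMeasure (gpLaw (postCov σ k n a)))⟩

/-- The law of the residual of `GP(0, k)` given a dataset. -/
noncomputable def residualKernel (σ : ℝ) (k : X → X → ℝ) (n : ℕ) :
    Kernel (Fin n → X × ℝ) (X → ℝ) :=
  (postKernel σ k n).comap (queries n) (measurable_queries n)

instance (σ : ℝ) (k : X → X → ℝ) (n : ℕ) : IsMarkovKernel (residualKernel σ k n) := by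
  unfold residualKernel; infer_instance

lemma residualKernel_apply (σ : ℝ) (k : X → X → ℝ) (n : ℕ) (d : Fin n → X × ℝ) :
    residualKernel σ k n d = gpLaw (postCov σ k n (queries n d)) := rfl

/-- The law of the prediction error of a new observation. -/
noncomputable def errorKernel (σ : ℝ) (k : X → X → ℝ) (n : ℕ) :
    Kernel ((Fin n → X × ℝ) × X) ℝ :=
  (Kernel.ofFunOfCountable fun q : (Fin n → X) × X ↦
      gaussianReal 0 (postCov σ k n q.1 q.2 q.2 + σ ^ 2).toNNReal).comap
    (fun q ↦ (queries n q.1, q.2)) (by have := measurable_queries (X := X) n; fun_prop)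

lemma errorKernel_apply (σ : ℝ) (k : X → X → ℝ) (n : ℕ) (q : (Fin n → X × ℝ) × X) :
    errorKernel σ k n q =
      gaussianReal 0 (postCov σ k n (queries n q.1) q.2 q.2 + σ ^ 2).toNNReal := rfl

instance (σ : ℝ) (k : X → X → ℝ) (n : ℕ) : IsMarkovKernel (errorKernel σ k n) :=
  ⟨fun q ↦ by rw [errorKernel_apply]; infer_instance⟩

lemma measurable_extendDataset (σ : ℝ) (k : X → X → ℝ) (n : ℕ) :
    Measurable (extendDataset σ k n) := by
  refine measurable_pi_lambda _ fun i ↦ ?_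
  have h := measurable_eval_point
    ((measurable_postMean σ k n).comp (measurable_fst.comp measurable_fst))
    (a := fun q : ((Fin n → X × ℝ) × X) × ℝ ↦ q.1.2) (by fun_prop)
  simp only [Function.comp_def] at h
  refine Fin.lastCases ?_ (fun i ↦ ?_) i
  · simp only [extendDataset, Fin.snoc_last]
    fun_prop
  · simp only [extendDataset, Fin.snoc_castSucc]
    fun_prop

variable {Ω : Type*} [MeasurableSpace Ω] {P : Measure Ω} [IsProbabilityMeasure P]
  {σ : ℝ} {k : X → X → ℝ} {f : Ω → X → ℝ} {ε : ℕ → Ω → ℝ} {x : ℕ → Ω → X}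

/-- A query chosen from the data does not inform on the residual. -/
lemma hasCondDistrib_residual_query {n : ℕ}
    (hR : HasCondDistrib (residual σ k f ε x n) (dataset f ε x n) (residualKernel σ k n) P)
    (hx : DrawnFrom (x n) (dataset f ε x n) f P) :
    HasCondDistrib (residual σ k f ε x n) (fun ω ↦ (dataset f ε x n ω, x n ω))
      (Kernel.prodMkRight X (residualKernel σ k n)) P := by
  obtain ⟨κ, hκ, hx⟩ := hx
  have hm := measurable_postMean σ k n
  exact (hx.comp_left (φ := fun p : (X → ℝ) × (Fin n → X × ℝ) ↦ p.1 - postMean σ k n p.2)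
    (by fun_prop)).hasCondDistrib_residual hR

/-- Given the data and the query, the old residual is `GP(0, postCov)` and the noise is independent
of it, so `map_observation_residual` applies for each fixed value of the pair. The error `0` in
`extendDataset` is a placeholder: `residualKernel` depends only on the query points. -/
lemma hasCondDistrib_error_residual (hσ : 0 < σ) (hk : (Matrix.of k).PosSemidef) {n : ℕ}
    (hR : HasCondDistrib (residual σ k f ε x n) (dataset f ε x n) (residualKernel σ k n) P)
    (hε : HasLaw (ε n) (noiseLaw σ) P)
    (hind : IndepFun (ε n) (fun ω ↦ (f ω, dataset f ε x n ω, x n ω)) P)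
    (hx : DrawnFrom (x n) (dataset f ε x n) f P) :
    HasCondDistrib
      (fun ω ↦ (residual σ k f ε x n ω (x n ω) + ε n ω, residual σ k f ε x (n + 1) ω))
      (fun ω ↦ (dataset f ε x n ω, x n ω))
      (errorKernel σ k n ×ₖ (residualKernel σ k (n + 1)).comap
        (fun q ↦ extendDataset σ k n (q, 0))
        ((measurable_extendDataset σ k n).comp (by fun_prop))) P := by
  have hm := measurable_postMean σ k n
  have hR' := hasCondDistrib_residual_query hR hx
  have hind' : IndepFun (ε n)
      (fun ω ↦ (residual σ k f ε x n ω, (dataset f ε x n ω, x n ω))) P :=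
    hind.comp (φ := id) (ψ := fun p : (X → ℝ) × (Fin n → X × ℝ) × X ↦
      (p.1 - postMean σ k n p.2.1, p.2)) measurable_id (by fun_prop)
  have h := (HasCondLaw.of_indepFun hε hR'.aemeasurable_snd hR'.aemeasurable_fst
    hind').hasCondDistrib_prod hR'
  let Φ : ((Fin n → X × ℝ) × X) × ((X → ℝ) × ℝ) → ℝ × (X → ℝ) := fun p ↦
    (p.2.1 p.1.2 + p.2.2, fun z ↦ p.2.1 z - postCov σ k n (queries n p.1.1) z p.1.2 /
      (postCov σ k n (queries n p.1.1) p.1.2 p.1.2 + σ ^ 2) * (p.2.1 p.1.2 + p.2.2))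
  have hΦ : Measurable Φ := by
    have h1 : Measurable fun p : ((Fin n → X × ℝ) × X) × ((X → ℝ) × ℝ) ↦ p.2.1 p.1.2 :=
      measurable_eval_point (by fun_prop) (by fun_prop)
    refine Measurable.prodMk (by fun_prop) (measurable_pi_lambda _ fun z ↦ ?_)
    have hq : Measurable fun p : ((Fin n → X × ℝ) × X) × ((X → ℝ) × ℝ) ↦
        (queries n p.1.1, p.1.2) := by
      have := measurable_queries (X := X) n
      fun_prop
    have hc : Measurable fun q : (Fin n → X) × X ↦
        postCov σ k n q.1 z q.2 / (postCov σ k n q.1 q.2 q.2 + σ ^ 2) := .of_discrete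
    have h3 := hc.comp hq
    simp only [Function.comp_def] at h3
    fun_prop
  convert! h.map_prodMk hΦ (η := errorKernel σ k n ×ₖ (residualKernel σ k (n + 1)).comap
        (fun q ↦ extendDataset σ k n (q, 0))
        ((measurable_extendDataset σ k n).comp (by fun_prop))) ?_ using 2 with ω
  · refine Prod.ext rfl ?_
    ext z
    exact residual_succ σ k f ε x n ω z
  · intro q
    rw [Kernel.prod_apply, Kernel.prod_apply, Kernel.prodMkRight_apply, Kernel.const_apply,
      residualKernel_apply, errorKernel_apply, Kernel.comap_apply, residualKernel_apply,
      queries_extendDataset, postCov_snoc]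
    exact map_observation_residual hσ (postCov_posSemidef hσ hk n (queries n q.1)) q.2

/-- Given the data, the objective is Gaussian with mean `postMean` and covariance `postCov`, even
though the queries are adaptive. -/
theorem hasCondDistrib_residual (hσ : 0 < σ) (hk : (Matrix.of k).PosSemidef)
    (hf : HasLaw f (gpLaw k) P) (n : ℕ) (hε : ∀ i < n, HasLaw (ε i) (noiseLaw σ) P)
    (hind : ∀ i < n, IndepFun (ε i) (fun ω ↦ (f ω, dataset f ε x i ω, x i ω)) P)
    (hx : ∀ i < n, DrawnFrom (x i) (dataset f ε x i) f P) :
    HasCondDistrib (residual σ k f ε x n) (dataset f ε x n) (residualKernel σ k n) P := by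
  induction n with
  | zero =>
    have hd : dataset f ε x 0 = fun _ ↦ Fin.elim0 := by
      ext1 ω; exact Subsingleton.elim _ _
    have hr : residual σ k f ε x 0 = f := by ext ω z; simp [residual, postMean]
    have hK : residualKernel σ k 0 = Kernel.const _ (gpLaw k) := by
      ext1 d; rfl
    have hfm := hf.aemeasurable
    rw [hd, hr, hK]
    refine ⟨by fun_prop, ?_⟩
    rw [Measure.compProd_const, ← hf.map_eq]
    exact (indepFun_iff_map_prod_eq_prod_map_map (by fun_prop) hfm).1
      (indepFun_const_left _ _)
  | succ n ih =>
    have hR := ih (fun i hi ↦ hε i (by omega)) (fun i hi ↦ hind i (by omega))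
      fun i hi ↦ hx i (by omega)
    have h := (hasCondDistrib_error_residual hσ hk hR (hε n n.lt_succ_self)
      (hind n n.lt_succ_self) (hx n n.lt_succ_self)).of_prod
    have hd : dataset f ε x (n + 1) = extendDataset σ k n ∘ fun ω ↦
        ((dataset f ε x n ω, x n ω), residual σ k f ε x n ω (x n ω) + ε n ω) := by
      ext1 ω; exact dataset_succ σ k f ε x n ω
    rw [hd]
    -- The new dataset is a function of the old data, the query and the error. The law of the
    -- residual given these three factors through that function, so it is also the law given the new
    -- dataset.
    refine HasCondDistrib.comp_right (hf := measurable_extendDataset σ k n) ?_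
    convert! h using 1
    ext1 q
    rw [Kernel.comap_apply, Kernel.prodMkRight_apply, Kernel.comap_apply, residualKernel_apply,
      residualKernel_apply, queries_extendDataset, queries_extendDataset]

end Residual

/-! ### Second moment of the largest standardized score -/

section GaussianMaxima

/-- The two open half-lines are disjoint and have equal mass by symmetry. This factor one half is
the source of `|X| / 2`, instead of `|X|`, in `C₂`. -/
lemma gaussianReal_Ioi_zero_le : gaussianReal 0 1 (Set.Ioi 0) ≤ ENNReal.ofReal (1 / 2) := by
  have h : gaussianReal 0 1 (Set.Iio 0) = gaussianReal 0 1 (Set.Ioi 0) := by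
    have h := gaussianReal_map_neg (μ := 0) (v := 1)
    rw [neg_zero] at h
    conv_lhs => rw [← h]
    rw [Measure.map_apply measurable_neg measurableSet_Iio]
    simp
  have h2 : gaussianReal 0 1 (Set.Iio 0) + gaussianReal 0 1 (Set.Ioi 0) ≤ 1 := by
    rw [← measure_union _ measurableSet_Ioi]
    · exact prob_le_one
    · exact Set.disjoint_left.2 fun x (hx : x < 0) (hx' : 0 < x) ↦ lt_asymm hx hx'
  rw [h, ← two_mul] at h2
  rw [ENNReal.ofReal_div_of_pos two_pos, ENNReal.le_div_iff_mul_le (by simp) (by simp), mul_comm]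
  simpa using h2

/-- After translation by `s`, the cross term in the exponent is nonpositive on the positive
half-line, so the shifted density is at most `exp (-s² / 2)` times the original one. -/
lemma gaussianReal_Ioi_le {s : ℝ} (hs : 0 ≤ s) :
    gaussianReal 0 1 (Set.Ioi s) ≤ ENNReal.ofReal (Real.exp (-s ^ 2 / 2) / 2) := by
  rw [gaussianReal_apply _ one_ne_zero, ← lintegral_indicator measurableSet_Ioi,
    ← lintegral_add_right_eq_self _ s]
  calc ∫⁻ x, (Set.Ioi s).indicator (gaussianPDF 0 1) (x + s)
      ≤ ∫⁻ x, ENNReal.ofReal (Real.exp (-s ^ 2 / 2)) *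
          (Set.Ioi 0).indicator (gaussianPDF 0 1) x := by
        refine lintegral_mono fun x ↦ ?_
        by_cases hx : 0 < x
        · rw [Set.indicator_of_mem (by simpa using hx), Set.indicator_of_mem (by simpa using hx),
            gaussianPDF, gaussianPDF, ← ENNReal.ofReal_mul (Real.exp_pos _).le]
          refine ENNReal.ofReal_le_ofReal ?_
          simp only [gaussianPDFReal, NNReal.coe_one, mul_one, sub_zero]
          rw [mul_left_comm, ← Real.exp_add]
          refine mul_le_mul_of_nonneg_left (Real.exp_le_exp.2 ?_) (by positivity)
          nlinarith
        · rw [Set.indicator_of_notMem (by simpa using hx)]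
          exact zero_le
    _ = ENNReal.ofReal (Real.exp (-s ^ 2 / 2)) * gaussianReal 0 1 (Set.Ioi 0) := by
        rw [lintegral_const_mul _ ((measurable_gaussianPDF 0 1).indicator measurableSet_Ioi),
          lintegral_indicator measurableSet_Ioi, gaussianReal_apply _ one_ne_zero]
    _ ≤ ENNReal.ofReal (Real.exp (-s ^ 2 / 2)) * ENNReal.ofReal (1 / 2) := by
        gcongr
        exact gaussianReal_Ioi_zero_le
    _ = _ := by
        rw [← ENNReal.ofReal_mul (Real.exp_pos _).le, mul_one_div]

variable {X : Type*}

/-- The positive part of the largest standardized value of `r`. -/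
noncomputable def maxScore (C : X → X → ℝ) (r : X → ℝ) : ℝ := ⨆ x, max (r x / √(C x x)) 0

lemma maxScore_nonneg (C : X → X → ℝ) (r : X → ℝ) : 0 ≤ maxScore C r :=
  Real.iSup_nonneg fun _ ↦ le_max_right _ _

variable [Fintype X]

lemma le_maxScore (C : X → X → ℝ) (r : X → ℝ) (x : X) : r x / √(C x x) ≤ maxScore C r :=
  (le_max_left _ _).trans (le_ciSup (f := fun x ↦ max (r x / √(C x x)) 0)
    (Set.finite_range _).bddAbove x)

@[fun_prop]
lemma measurable_maxScore (C : X → X → ℝ) : Measurable (maxScore C) := by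
  unfold maxScore
  exact Measurable.iSup fun x ↦ by fun_prop

lemma gpLaw_score_gt_le {C : X → X → ℝ} (hC : (Matrix.of C).PosSemidef) (x : X) {s : ℝ}
    (hs : 0 ≤ s) :
    gpLaw C {r | s < r x / √(C x x)} ≤ ENNReal.ofReal (Real.exp (-s ^ 2 / 2) / 2) := by
  rcases (diag_nonneg hC x).eq_or_lt with h0 | h0
  -- At zero variance the score is a division by zero, hence `0`.
  · simp [← h0, hs.not_gt]
  · have h1 : (gpLaw C).map (fun r ↦ r x / √(C x x)) = gaussianReal 0 1 := by
      rw [show (fun r : X → ℝ ↦ r x / √(C x x)) = (fun y ↦ y / √(C x x)) ∘ fun r ↦ r x from rfl,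
        ← Measure.map_map (by fun_prop) (by fun_prop), map_eval_gpLaw hC,
        gaussianReal_map_div_const, zero_div]
      congr 1
      ext
      simp [Real.sq_sqrt h0.le, h0.le, h0.ne']
    have := gaussianReal_Ioi_le hs
    rwa [← h1, Measure.map_apply (by fun_prop) measurableSet_Ioi] at this

lemma gpLaw_maxScore_sq_gt_le {C : X → X → ℝ} (hC : (Matrix.of C).PosSemidef) {u : ℝ}
    (hu : 0 ≤ u) :
    gpLaw C {r | u < maxScore C r ^ 2} ≤
      ENNReal.ofReal (Fintype.card X * (Real.exp (-(1 / 2) * u) / 2)) := by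
  have hsub : {r | u < maxScore C r ^ 2} ⊆ ⋃ x, {r | √u < r x / √(C x x)} := by
    intro r hr
    have h1 : √u < maxScore C r := (Real.sqrt_lt' (by
      refine (maxScore_nonneg C r).lt_of_ne fun h ↦ ?_
      rw [Set.mem_ofPred_eq, ← h] at hr
      norm_num at hr
      exact hu.not_gt hr)).2 hr
    have : Nonempty X := by
      by_contra hX
      rw [not_nonempty_iff] at hX
      rw [maxScore, Real.iSup_of_isEmpty] at h1
      exact (Real.sqrt_nonneg u).not_gt h1
    obtain ⟨x, hx⟩ := exists_lt_of_lt_ciSup h1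
    refine Set.mem_iUnion.2 ⟨x, ?_⟩
    rcases lt_max_iff.1 hx with h | h
    · exact h
    · exact absurd h (Real.sqrt_nonneg u).not_gt
  refine (measure_mono hsub).trans ((measure_iUnion_le _).trans ?_)
  rw [tsum_fintype]
  refine (Finset.sum_le_sum fun x _ ↦ gpLaw_score_gt_le hC x (Real.sqrt_nonneg u)).trans ?_
  rw [Finset.sum_const, Finset.card_univ, nsmul_eq_mul, Real.sq_sqrt hu,
    ENNReal.ofReal_mul (Nat.cast_nonneg _), ENNReal.ofReal_natCast]
  gcongr
  exact (by ring : -u / 2 = -(1 / 2) * u).le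

/-- The second moment of the positive part of the maximum of `n ≥ 2` standard Gaussians is at
most `2 + 2 log (n / 2)`. -/
lemma lintegral_maxScore_sq_le (hX : 2 ≤ Fintype.card X) {C : X → X → ℝ}
    (hC : (Matrix.of C).PosSemidef) :
    ∫⁻ r, ENNReal.ofReal (maxScore C r ^ 2) ∂gpLaw C ≤
      ENNReal.ofReal (2 + 2 * Real.log ((Fintype.card X : ℝ) / 2)) := by
  set n : ℝ := ((Fintype.card X : ℕ) : ℝ) with hn
  have hn2 : 2 ≤ n := by rw [hn]; exact_mod_cast hX
  -- At the threshold `l` the union bound `n exp (-u / 2) / 2` equals 1. Below it probabilities are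
  -- bounded by 1, contributing `l`; above it the tail integrates to `n exp (-l / 2) = 2`. The
  -- assumption `n ≥ 2` makes `l` nonnegative.
  set l : ℝ := 2 * Real.log (n / 2) with hl
  have hl0 : 0 ≤ l := by
    have := Real.log_nonneg (show 1 ≤ n / 2 by linarith)
    positivity
  have hexp : Real.exp (-(1 / 2) * l) = 2 / n := by
    rw [show -(1 / 2) * l = -Real.log (n / 2) by rw [hl]; ring, Real.exp_neg,
      Real.exp_log (by positivity), inv_div]
  rw [lintegral_eq_lintegral_meas_lt _ (.of_forall fun r ↦ sq_nonneg _) (by fun_prop),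
    ← Set.Ioc_union_Ioi_eq_Ioi hl0,
    lintegral_union measurableSet_Ioi (Set.disjoint_left.2 fun u hu hu' ↦ hu.2.not_gt hu')]
  have h1 : ∫⁻ u in Set.Ioc 0 l, gpLaw C {r | u < maxScore C r ^ 2} ≤ ENNReal.ofReal l := by
    refine (lintegral_mono fun u ↦ prob_le_one).trans ?_
    simp
  have h2 : ∫⁻ u in Set.Ioi l, gpLaw C {r | u < maxScore C r ^ 2} ≤ ENNReal.ofReal 2 := by
    refine (setLIntegral_mono' measurableSet_Ioi fun u hu ↦
      gpLaw_maxScore_sq_gt_le hC (hl0.trans (le_of_lt hu))).trans ?_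
    have hi : IntegrableOn (fun u : ℝ ↦ n * (Real.exp (-(1 / 2) * u) / 2)) (Set.Ioi l) :=
      ((integrableOn_exp_mul_Ioi (by norm_num) l).div_const 2).const_mul n
    rw [← ofReal_integral_eq_lintegral_ofReal hi (.of_forall fun u ↦ by positivity)]
    refine ENNReal.ofReal_le_ofReal (le_of_eq ?_)
    rw [integral_const_mul, integral_div, integral_exp_mul_Ioi (by norm_num), hexp]
    field_simp
  refine (add_le_add h1 h2).trans ?_
  rw [← ENNReal.ofReal_add hl0 zero_le_two, add_comm]

end GaussianMaxima

/-! ### Relative entropy between Gaussian kernels -/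

section KullbackLeibler

variable {α β : Type*} [MeasurableSpace α] [MeasurableSpace β]

/-- The data processing inequality, applied to `g` and then to its left inverse. -/
lemma klDiv_map_of_leftInverse (μ ν : Measure α) [IsFiniteMeasure μ] [IsFiniteMeasure ν]
    {g : α → β} {h : β → α} (hg : Measurable g) (hh : Measurable h)
    (hhg : Function.LeftInverse h g) :
    InformationTheory.klDiv (μ.map g) (ν.map g) = InformationTheory.klDiv μ ν := by
  refine le_antisymm (InformationTheory.klDiv_map_le _ _ hg) ?_
  have h1 (ρ : Measure α) : (ρ.map g).map h = ρ := by
    rw [Measure.map_map hh hg, hhg.comp_eq_id, Measure.map_id]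
  calc InformationTheory.klDiv μ ν
      = InformationTheory.klDiv ((μ.map g).map h) ((ν.map g).map h) := by rw [h1, h1]
    _ ≤ _ := InformationTheory.klDiv_map_le _ _ hh

lemma klDiv_withDensity_exp {μ ν : Measure α} [IsProbabilityMeasure μ] [IsProbabilityMeasure ν]
    {h : α → ℝ} (hh : Measurable h)
    (hμ : μ = ν.withDensity fun a ↦ ENNReal.ofReal (Real.exp (h a))) (hi : Integrable h μ) :
    InformationTheory.klDiv μ ν = ENNReal.ofReal (∫ a, h a ∂μ) := by
  have hac : μ ≪ ν := hμ ▸ withDensity_absolutelyContinuous _ _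
  have hr : μ.rnDeriv ν =ᵐ[ν] fun a ↦ ENNReal.ofReal (Real.exp (h a)) := by
    conv_lhs => rw [hμ]
    exact Measure.rnDeriv_withDensity _ (by fun_prop)
  have hl : llr μ ν =ᵐ[μ] h := by
    filter_upwards [hac.ae_le hr] with a ha
    rw [llr, ha, ENNReal.toReal_ofReal (Real.exp_pos _).le, Real.log_exp]
  have hli : Integrable (llr μ ν) μ := hi.congr hl.symm
  rw [← integral_congr_ae hl,
    ← InformationTheory.toReal_klDiv_of_measure_eq hac (by simp),
    ENNReal.ofReal_toReal (InformationTheory.klDiv_ne_top hac hli)]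

/-- The Markov kernel of Gaussian laws with mean `m` and variance `v`. -/
noncomputable def gaussianKernel (m : α → ℝ) (hm : Measurable m) (v : NNReal) : Kernel α ℝ :=
  ⟨fun a ↦ gaussianReal (m a) v, measurable_gaussianReal.comp (hm.prodMk measurable_const)⟩

lemma gaussianKernel_apply (m : α → ℝ) (hm : Measurable m) (v : NNReal) (a : α) :
    gaussianKernel m hm v a = gaussianReal (m a) v := rfl

instance (m : α → ℝ) (hm : Measurable m) (v : NNReal) : IsMarkovKernel (gaussianKernel m hm v) :=
  ⟨fun a ↦ by rw [gaussianKernel_apply]; infer_instance⟩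

/-- The log-likelihood ratio of two Gaussians. -/
noncomputable def gaussianLogRatio (s v : NNReal) (a m y : ℝ) : ℝ :=
  Real.log (v / s) / 2 - (y - a) ^ 2 / (2 * s) + (y - m) ^ 2 / (2 * v)

lemma gaussianReal_eq_withDensity {s v : NNReal} (hs : s ≠ 0) (hv : v ≠ 0) (a m : ℝ) :
    gaussianReal a s = (gaussianReal m v).withDensity
      fun y ↦ ENNReal.ofReal (Real.exp (gaussianLogRatio s v a m y)) := by
  have hs' : (0 : ℝ) < s := NNReal.coe_pos.2 (pos_iff_ne_zero.2 hs)
  have hv' : (0 : ℝ) < v := NNReal.coe_pos.2 (pos_iff_ne_zero.2 hv)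
  rw [gaussianReal_of_var_ne_zero _ hs, gaussianReal_of_var_ne_zero _ hv,
    ← withDensity_mul _ (measurable_gaussianPDF _ _) (by unfold gaussianLogRatio; fun_prop)]
  congr 1
  ext1 y
  rw [Pi.mul_apply, gaussianPDF, gaussianPDF, ← ENNReal.ofReal_mul (gaussianPDFReal_nonneg _ _ _)]
  congr 1
  have hsq : Real.exp (Real.log (v / s) / 2) = √v / √s := by
    rw [← Real.sqrt_div hv'.le, Real.exp_half, Real.exp_log (by positivity)]
  rw [gaussianLogRatio, add_comm, add_sub, add_sub_right_comm, add_comm, Real.exp_add, hsq,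
    gaussianPDFReal, gaussianPDFReal, mul_mul_mul_comm, ← Real.exp_add,
    Real.sqrt_mul (by positivity) (s : ℝ), Real.sqrt_mul (by positivity) (v : ℝ)]
  congr 1
  · field_simp
  · congr 1
    ring

lemma integral_sq_gaussianReal (v : NNReal) : ∫ y, y ^ 2 ∂gaussianReal 0 v = v := by
  have h := variance_fun_id_gaussianReal (μ := 0) (v := v)
  rw [variance_eq_integral (by fun_prop)] at h
  simpa using h

lemma integrable_sq_gaussianReal (v : NNReal) :
    Integrable (fun y ↦ y ^ 2) (gaussianReal 0 v) :=
  (memLp_id_gaussianReal (μ := 0) (v := v) 2).integrable_sq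

/-- If `Y - a` and `Y - m` are centred Gaussians of variance `s` and `v`, the conditional relative
entropy of `N(a, s)` with respect to `N(m, v)` is `log (v / s) / 2`. -/
lemma klDiv_compProd_gaussianKernel {Ω : Type*} [MeasurableSpace Ω] {P : Measure Ω}
    [IsProbabilityMeasure P] {Z : Ω → α} {Y : Ω → ℝ} {s v : NNReal} (hs : s ≠ 0) (hv : v ≠ 0)
    {a m : α → ℝ} (ha : Measurable a) (hm : Measurable m)
    (hY : HasCondDistrib Y Z (gaussianKernel a ha s) P)
    (hYa : HasLaw (fun ω ↦ Y ω - a (Z ω)) (gaussianReal 0 s) P)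
    (hYm : HasLaw (fun ω ↦ Y ω - m (Z ω)) (gaussianReal 0 v) P) :
    InformationTheory.klDiv (P.map Z ⊗ₘ gaussianKernel a ha s) (P.map Z ⊗ₘ gaussianKernel m hm v) =
      ENNReal.ofReal (Real.log (v / s) / 2) := by
  have hs' : (0 : ℝ) < s := NNReal.coe_pos.2 (pos_iff_ne_zero.2 hs)
  have hv' : (0 : ℝ) < v := NNReal.coe_pos.2 (pos_iff_ne_zero.2 hv)
  have hZm := hY.aemeasurable_fst
  have : IsProbabilityMeasure (P.map Z) := Measure.isProbabilityMeasure_map hZm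
  have hH : Measurable fun p : α × ℝ ↦ gaussianLogRatio s v (a p.1) (m p.1) p.2 := by
    unfold gaussianLogRatio; fun_prop
  have hκ : gaussianKernel a ha s = (gaussianKernel m hm v).withDensity
      fun z y ↦ ENNReal.ofReal (Real.exp (gaussianLogRatio s v (a z) (m z) y)) := by
    ext1 z
    rw [Kernel.withDensity_apply _ (by fun_prop)]
    exact gaussianReal_eq_withDensity hs hv _ _
  have hμ : P.map Z ⊗ₘ gaussianKernel a ha s = (P.map Z ⊗ₘ gaussianKernel m hm v).withDensity
      fun p ↦ ENNReal.ofReal (Real.exp (gaussianLogRatio s v (a p.1) (m p.1) p.2)) := by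
    have : IsSFiniteKernel ((gaussianKernel m hm v).withDensity
      fun z y ↦ ENNReal.ofReal (Real.exp (gaussianLogRatio s v (a z) (m z) y))) := by
      rw [← hκ]; infer_instance
    rw [hκ, Measure.compProd_withDensity (by fun_prop)]
  have hYam := hYa.aemeasurable
  have hYmm := hYm.aemeasurable
  have hia : Integrable (fun ω ↦ (Y ω - a (Z ω)) ^ 2) P := by
    have h := integrable_sq_gaussianReal s
    rw [← hYa.map_eq] at h
    exact h.comp_aemeasurable hYam
  have him : Integrable (fun ω ↦ (Y ω - m (Z ω)) ^ 2) P := by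
    have h := integrable_sq_gaussianReal v
    rw [← hYm.map_eq] at h
    exact h.comp_aemeasurable hYmm
  have hI : Integrable (fun ω ↦ gaussianLogRatio s v (a (Z ω)) (m (Z ω)) (Y ω)) P :=
    ((integrable_const _).sub (hia.div_const _)).add (him.div_const _)
  rw [klDiv_withDensity_exp hH hμ]
  · rw [← hY.map_eq, integral_map hY.aemeasurable hH.aestronglyMeasurable]
    simp only [gaussianLogRatio]
    rw [integral_add (f := fun ω ↦ Real.log (v / s) / 2 - (Y ω - a (Z ω)) ^ 2 / (2 * s))
        ((integrable_const _).sub (hia.div_const _)) (him.div_const _),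
      integral_sub (integrable_const _) (hia.div_const _), integral_div, integral_div, integral_div]
    -- Each quadratic term of the log-ratio has mean one half in absolute value; the two cancel and
    -- leave the logarithm.
    have e1 : ∫ ω, (Y ω - a (Z ω)) ^ 2 ∂P = s :=
      (hYa.integral_comp (f := fun y ↦ y ^ 2) (by fun_prop)).trans (integral_sq_gaussianReal s)
    have e2 : ∫ ω, (Y ω - m (Z ω)) ^ 2 ∂P = v :=
      (hYm.integral_comp (f := fun y ↦ y ^ 2) (by fun_prop)).trans (integral_sq_gaussianReal v)
    rw [e1, e2]
    congr 1
    simp only [integral_const, probReal_univ, one_smul]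
    field_simp
    ring
  · rw [← hY.map_eq, integrable_map_measure hH.aestronglyMeasurable hY.aemeasurable]
    exact hI

end KullbackLeibler

/-! ### Chain rule for the information of deterministic queries -/

section InformationGain

/-- Reordering a product of a composition-product. -/
lemma compProd_prod_eq_map {α β γ : Type*} [MeasurableSpace α] [MeasurableSpace β]
    [MeasurableSpace γ] (μ : Measure α) (ν : Measure γ) [IsProbabilityMeasure μ]
    [IsProbabilityMeasure ν] (κ : Kernel α β) [IsMarkovKernel κ] :
    (μ ⊗ₘ κ).prod ν =
      ((μ.prod ν) ⊗ₘ Kernel.prodMkRight γ κ).map (fun p ↦ ((p.1.1, p.2), p.1.2)) := by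
  refine Measure.ext_of_lintegral _ fun F hF ↦ ?_
  have hg : Measurable fun p : (α × γ) × β ↦ ((p.1.1, p.2), p.1.2) := by fun_prop
  rw [lintegral_map hF hg,
    Measure.lintegral_compProd (f := fun p : (α × γ) × β ↦ F ((p.1.1, p.2), p.1.2)) (hF.comp hg),
    lintegral_prod _ hF.aemeasurable,
    Measure.lintegral_compProd (by fun_prop),
    lintegral_prod _ (Measurable.aemeasurable (Measurable.lintegral_kernel_prod_right (by fun_prop)))]
  refine lintegral_congr fun x ↦ ?_
  rw [lintegral_lintegral_swap (by fun_prop)]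
  rfl

lemma indepFun_snd_of_indepFun {α β γ δ : Type*} [MeasurableSpace α] [MeasurableSpace β]
    [MeasurableSpace γ] [MeasurableSpace δ] (μ : Measure α) (ν : Measure β)
    [IsProbabilityMeasure μ] [IsProbabilityMeasure ν] {U : β → γ} {V : β → δ}
    (hU : Measurable U) (hV : Measurable V) (h : IndepFun U V ν) :
    IndepFun (fun p : α × β ↦ U p.2) (fun p : α × β ↦ (p.1, V p.2)) (μ.prod ν) := by
  rw [indepFun_iff_measure_inter_preimage_eq_mul]
  intro s t hs ht
  have hs' : MeasurableSet ((fun p : α × β ↦ U p.2) ⁻¹' s) := (hU.comp measurable_snd) hs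
  have ht' : MeasurableSet ((fun p : α × β ↦ (p.1, V p.2)) ⁻¹' t) :=
    (measurable_fst.prodMk (hV.comp measurable_snd)) ht
  rw [Measure.prod_apply (hs'.inter ht'), Measure.prod_apply ht', Measure.prod_apply hs']
  have h1 (x : α) : ν (Prod.mk x ⁻¹'
      ((fun p : α × β ↦ U p.2) ⁻¹' s ∩ (fun p : α × β ↦ (p.1, V p.2)) ⁻¹' t)) =
      ν (U ⁻¹' s) * ν (Prod.mk x ⁻¹' ((fun p : α × β ↦ (p.1, V p.2)) ⁻¹' t)) :=
    indepFun_iff_measure_inter_preimage_eq_mul.1 h s (Prod.mk x ⁻¹' t) hs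
      (measurable_prodMk_left ht)
  have h2 (x : α) : ν (Prod.mk x ⁻¹' ((fun p : α × β ↦ U p.2) ⁻¹' s)) = ν (U ⁻¹' s) := rfl
  simp only [h1, h2, lintegral_const, measure_univ, mul_one]
  rw [lintegral_const_mul _ (measurable_measure_prodMk_left ht')]

lemma map_const_add_eq_gaussianKernel {α : Type*} [MeasurableSpace α] (m : α → ℝ)
    (hm : Measurable m) (v : NNReal) (z : α) :
    (gaussianReal 0 v).map (fun e ↦ m z + e) = gaussianKernel m hm v z := by
  rw [gaussianReal_map_const_add, zero_add, gaussianKernel_apply]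

lemma log_one_add_postCov_nonneg {X : Type*} [Fintype X] {σ : ℝ} {k : X → X → ℝ} (hσ : 0 < σ)
    (hk : (Matrix.of k).PosSemidef) (n : ℕ) (a : Fin n → X) (x : X) :
    0 ≤ Real.log (1 + postCov σ k n a x x / σ ^ 2) / 2 := by
  have := diag_nonneg (postCov_posSemidef hσ hk n a) x
  have : 0 ≤ postCov σ k n a x x / σ ^ 2 := by positivity
  exact div_nonneg (Real.log_nonneg (by linarith)) zero_le_two

variable {X : Type*} [Fintype X] [MeasurableSpace X] [MeasurableSingletonClass X]
  {Ω : Type*} [MeasurableSpace Ω] {P : Measure Ω} [IsProbabilityMeasure P]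
  {σ : ℝ} {k : X → X → ℝ} {f : Ω → X → ℝ} {ε : ℕ → Ω → ℝ}

/-- The mutual information between the observations at deterministic points and a statistic of the
objective which determines its values at these points. -/
lemma mutualInfo_dataset (hσ : 0 < σ) (hk : (Matrix.of k).PosSemidef)
    (hf : HasLaw f (gpLaw k) P) (a : ℕ → X) {γ : Type*} [MeasurableSpace γ] {S : (X → ℝ) → γ}
    (hS : Measurable S) (n : ℕ) {b : ℕ → γ → ℝ} (hb : ∀ i, Measurable (b i))
    (hbS : ∀ i < n, ∀ r, b i (S r) = r (a i))
    (hε : ∀ i < n, HasLaw (ε i) (noiseLaw σ) P)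
    (hind : ∀ i < n, IndepFun (ε i) (fun ω ↦ (f ω, dataset f ε (fun i _ ↦ a i) i ω, a i)) P) :
    mutualInfo P (dataset f ε (fun i _ ↦ a i) n) (fun ω ↦ S (f ω)) =
      ENNReal.ofReal (∑ i ∈ Finset.range n,
        Real.log (1 + postCov σ k i (fun j ↦ a j) (a i) (a i) / σ ^ 2) / 2) := by
  have hfm := hf.aemeasurable
  have hSf : AEMeasurable (fun ω ↦ S (f ω)) P := hS.comp_aemeasurable hfm
  have : IsProbabilityMeasure (P.map fun ω ↦ S (f ω)) := Measure.isProbabilityMeasure_map hSf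
  induction n with
  | zero =>
    have hd : dataset f ε (fun i _ ↦ a i) 0 = fun _ ↦ Fin.elim0 := by
      ext1 ω; exact Subsingleton.elim _ _
    rw [mutualInfo, hd, (indepFun_iff_map_prod_eq_prod_map_map (by fun_prop) hSf).1
      (indepFun_const_left _ _), InformationTheory.klDiv_self]
    simp
  | succ n ih =>
    have ih := ih (fun i hi ↦ hbS i (by omega)) (fun i hi ↦ hε i (by omega))
      fun i hi ↦ hind i (by omega)
    set D := dataset f ε (fun i _ ↦ a i) n with hD
    set c := postCov σ k n (fun j ↦ a j) (a n) (a n) with hc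
    have hc0 : 0 ≤ c := diag_nonneg (postCov_posSemidef hσ hk n _) _
    have hv0 : 0 < c + σ ^ 2 := by positivity
    set v := (c + σ ^ 2).toNNReal with hv
    set s := (σ ^ 2).toNNReal with hs
    have hvne : v ≠ 0 := by simpa [hv] using hv0
    have hsne : s ≠ 0 := by simpa [hs] using by positivity
    have hdm (i : ℕ) (hi : i ≤ n) : AEMeasurable (dataset f ε (fun i _ ↦ a i) i) P := by
      refine aemeasurable_pi_lambda _ fun j ↦ ?_
      have h1 := (hε j (by omega)).aemeasurable
      have h2 : AEMeasurable (fun ω ↦ f ω (a j)) P := (measurable_pi_apply _).comp_aemeasurable hfm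
      exact aemeasurable_const.prodMk (h2.add h1)
    have hDm : AEMeasurable D P := hdm n le_rfl
    have : IsProbabilityMeasure (P.map D) := Measure.isProbabilityMeasure_map hDm
    have hdraw (i : ℕ) (hi : i ≤ n) :
        DrawnFrom (fun _ ↦ a i) (dataset f ε (fun i _ ↦ a i) i) f P :=
      ⟨Kernel.const _ (Measure.dirac (a i)), inferInstance,
        HasCondLaw.of_indepFun ⟨aemeasurable_const, by simp⟩ hfm (hdm i hi)
          (indepFun_const_left _ _)⟩
    have hR := hasCondDistrib_residual hσ hk hf n (x := fun i _ ↦ a i)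
      (fun i hi ↦ hε i (by omega)) (fun i hi ↦ hind i (by omega)) fun i hi ↦ hdraw i hi.le
    have he := (hasCondDistrib_error_residual hσ hk hR (hε n n.lt_succ_self)
      (hind n n.lt_succ_self) (hdraw n le_rfl)).fst
    rw [Kernel.fst_prod] at he
    set e : Ω → ℝ := fun ω ↦ residual σ k f ε (fun i _ ↦ a i) n ω (a n) + ε n ω with he_def
    -- The query points are deterministic, so the error variance is almost surely the constant `v`,
    -- and the error is independent of the data.
    have hq : ∀ᵐ q ∂P.map (fun ω ↦ (D ω, a n)),
        errorKernel σ k n q = Kernel.const _ (gaussianReal 0 v) q := by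
      have hm : Measurable fun q : (Fin n → X × ℝ) × X ↦ (queries n q.1, q.2) := by
        have := measurable_queries (X := X) n
        fun_prop
      have h : ∀ᵐ q ∂P.map (fun ω ↦ (D ω, a n)),
          (queries n q.1, q.2) = ((fun j ↦ a j, a n) : (Fin n → X) × X) :=
        (ae_map_iff (f := fun ω ↦ (D ω, a n)) (by fun_prop)
          (hm (measurableSet_singleton ((fun j ↦ a j, a n) : (Fin n → X) × X)))).2
          (.of_forall fun ω ↦ rfl)
      filter_upwards [h] with q hq
      rw [Prod.mk.injEq] at hq
      rw [errorKernel_apply, hq.1, hq.2, Kernel.const_apply]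
    have he' : HasCondDistrib e (fun ω ↦ (D ω, a n)) (Kernel.const _ (gaussianReal 0 v)) P :=
      ⟨he.aemeasurable, he.map_eq.trans (Measure.compProd_congr hq)⟩
    have heD : HasCondDistrib e D (Kernel.const _ (gaussianReal 0 v)) P :=
      HasCondDistrib.comp_right (f := Prod.fst) (hf := measurable_fst)
        (Z := fun ω ↦ (D ω, a n)) (κ := Kernel.const _ (gaussianReal 0 v)) he'
    have hm : Measurable fun d : Fin n → X × ℝ ↦ postMean σ k n d (a n) :=
      (measurable_pi_apply _).comp (measurable_postMean σ k n)
    set y : Ω → ℝ := fun ω ↦ f ω (a n) + ε n ω with hy_def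
    have hye (ω : Ω) : y ω = postMean σ k n (D ω) (a n) + e ω := by
      simp only [hy_def, he_def, residual, Pi.sub_apply, ← hD]
      ring
    have hyD : HasCondDistrib y D (gaussianKernel _ hm v) P := by
      rw [funext hye]
      refine heD.map_prodMk (Φ := fun p ↦ postMean σ k n p.1 (a n) + p.2) (by fun_prop) fun d ↦ ?_
      rw [Kernel.const_apply]
      exact map_const_add_eq_gaussianKernel _ hm v d
    -- Once `S (f ω)` is also known, so is `f ω (a n)`, and only the noise variance `s` remains. The
    -- new information is the entropy of this law relative to the prediction from the data alone.
    have hyS : HasCondDistrib y (fun ω ↦ (D ω, S (f ω)))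
        (gaussianKernel (fun p ↦ b n p.2) ((hb n).comp measurable_snd) s) P := by
      have hi : IndepFun (ε n) (fun ω ↦ (D ω, S (f ω))) P :=
        (hind n n.lt_succ_self).comp (φ := id)
          (ψ := fun p : (X → ℝ) × (Fin n → X × ℝ) × X ↦ (p.2.1, S p.1)) measurable_id (by fun_prop)
      have h := HasCondLaw.of_indepFun (hε n n.lt_succ_self) hDm hSf hi
      have hyb (ω : Ω) : y ω = b n (S (f ω)) + ε n ω := by
        rw [hbS n n.lt_succ_self]
      rw [funext hyb]
      have hbn := hb n
      refine HasCondDistrib.map_prodMk h (Φ := fun p ↦ b n p.1.2 + p.2) (by fun_prop) fun p ↦ ?_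
      rw [Kernel.prodMkLeft_apply, Kernel.const_apply, noiseLaw]
      exact map_const_add_eq_gaussianKernel (fun p : (Fin n → X × ℝ) × γ ↦ b n p.2)
        ((hb n).comp measurable_snd) s p
    let g : ((Fin n → X × ℝ) × γ) × ℝ → (Fin (n + 1) → X × ℝ) × γ :=
      fun p ↦ (Fin.snoc (α := fun _ ↦ X × ℝ) p.1.1 (a n, p.2), p.1.2)
    let g₀ : (Fin n → X × ℝ) × ℝ → (Fin (n + 1) → X × ℝ) :=
      fun p ↦ Fin.snoc (α := fun _ ↦ X × ℝ) p.1 (a n, p.2)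
    let h : (Fin (n + 1) → X × ℝ) × γ → ((Fin n → X × ℝ) × γ) × ℝ :=
      fun p ↦ ((Fin.init p.1, p.2), (p.1 (Fin.last n)).2)
    have hg₀ : Measurable g₀ := by
      refine measurable_pi_lambda _ fun i ↦ ?_
      refine Fin.lastCases ?_ (fun i ↦ ?_) i
      · simp only [g₀, Fin.snoc_last]; fun_prop
      · simp only [g₀, Fin.snoc_castSucc]; fun_prop
    have hg : Measurable g :=
      (hg₀.comp ((measurable_fst.comp measurable_fst).prodMk measurable_snd)).prodMk
        (measurable_snd.comp measurable_fst)
    have hh : Measurable h := by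
      have : Measurable fun d : Fin (n + 1) → X × ℝ ↦ Fin.init d :=
        measurable_pi_lambda _ fun i ↦ measurable_pi_apply _
      fun_prop
    have hhg : Function.LeftInverse h g := fun p ↦ by simp [h, g]
    have hD' : dataset f ε (fun i _ ↦ a i) (n + 1) = fun ω ↦ g₀ (D ω, y ω) := by
      ext1 ω
      ext i : 1
      refine Fin.lastCases ?_ (fun i ↦ ?_) i
      · simp [dataset, observation, g₀, hy_def]
      · simp [dataset, observation, g₀, hD]
    have hym : AEMeasurable y P := hyD.aemeasurable_snd
    have hJ : P.map (fun ω ↦ (dataset f ε (fun i _ ↦ a i) (n + 1) ω, S (f ω))) =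
        (P.map (fun ω ↦ (D ω, S (f ω))) ⊗ₘ
          gaussianKernel (fun p ↦ b n p.2) ((hb n).comp measurable_snd) s).map g := by
      rw [← hyS.map_eq, AEMeasurable.map_map_of_aemeasurable (by fun_prop) (by fun_prop), hD']
      rfl
    have hQ : (P.map (dataset f ε (fun i _ ↦ a i) (n + 1))).prod (P.map fun ω ↦ S (f ω)) =
        (((P.map D).prod (P.map fun ω ↦ S (f ω))) ⊗ₘ
          gaussianKernel (fun p ↦ postMean σ k n p.1 (a n)) (hm.comp measurable_fst) v).map g := by
      have h1 : P.map (dataset f ε (fun i _ ↦ a i) (n + 1)) =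
          (P.map D ⊗ₘ gaussianKernel _ hm v).map g₀ := by
        rw [← hyD.map_eq, AEMeasurable.map_map_of_aemeasurable (by fun_prop) (by fun_prop), hD']
        rfl
      have h2 := Measure.map_prod_map (P.map D ⊗ₘ gaussianKernel _ hm v)
        (P.map fun ω ↦ S (f ω)) hg₀ measurable_id
      rw [Measure.map_id] at h2
      rw [h1, h2, compProd_prod_eq_map, Measure.map_map (hg₀.prodMap measurable_id) (by fun_prop)]
      rfl
    have hYa : HasLaw (fun ω ↦ y ω - b n (S (f ω))) (gaussianReal 0 s) P := by
      refine (hε n n.lt_succ_self).congr (.of_forall fun ω ↦ ?_)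
      simp only [hy_def, hbS n n.lt_succ_self]
      ring
    have hYm : HasLaw (fun ω ↦ y ω - postMean σ k n (D ω) (a n)) (gaussianReal 0 v) P := by
      refine he'.hasLaw_of_const.congr (.of_forall fun ω ↦ ?_)
      simp only [hye]
      ring
    have hkl := klDiv_compProd_gaussianKernel (Z := fun ω ↦ (D ω, S (f ω)))
      (a := fun p : (Fin n → X × ℝ) × γ ↦ b n p.2)
      (m := fun p : (Fin n → X × ℝ) × γ ↦ postMean σ k n p.1 (a n)) hsne hvne
      ((hb n).comp measurable_snd) (hm.comp measurable_fst) hyS hYa hYm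
    -- The joint law and the product of the marginals are images under the same injective map `g`.
    -- The chain rule then splits off the information of the first `n` observations.
    rw [mutualInfo, hJ, hQ, klDiv_map_of_leftInverse _ _ hg hh hhg,
      InformationTheory.klDiv_compProd_eq_add, hkl]
    have hsum : 0 ≤ ∑ i ∈ Finset.range n,
        Real.log (1 + postCov σ k i (fun j ↦ a j) (a i) (a i) / σ ^ 2) / 2 :=
      Finset.sum_nonneg fun i _ ↦ log_one_add_postCov_nonneg hσ hk i (fun j ↦ a j) (a i)
    have hlog : Real.log (v / s) / 2 = Real.log (1 + c / σ ^ 2) / 2 := by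
      rw [hv, hs, Real.coe_toNNReal _ hv0.le, Real.coe_toNNReal _ (sq_nonneg σ), add_div,
        div_self (by positivity), add_comm]
    rw [← mutualInfo, ih, Finset.sum_range_succ, ← hc, hlog,
      ENNReal.ofReal_add hsum (log_one_add_postCov_nonneg hσ hk n (fun j ↦ a j) (a n))]

end InformationGain

/-! ### Posterior variances against the maximum information gain -/

section MaximumInformationGain

variable {X : Type*} [Fintype X] [MeasurableSpace X] [MeasurableSingletonClass X]
  {σ : ℝ} {k : X → X → ℝ}

lemma indepFun_eval_pi {T : ℕ} (μ : Measure ℝ) [IsProbabilityMeasure μ] (i : Fin T) :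
    IndepFun (fun y : Fin T → ℝ ↦ y i) (fun y (j : {j // j ∈ Finset.univ.filter (· < i)}) ↦ y j)
      (Measure.pi fun _ : Fin T ↦ μ) := by
  have h := (iIndepFun_pi (μ := fun _ : Fin T ↦ μ) (X := fun _ ↦ id)
    (fun _ ↦ aemeasurable_id)).indepFun_finset {i} (Finset.univ.filter (· < i))
    (by simp) (fun _ ↦ measurable_pi_apply _)
  have hφ : Measurable fun z : {j // j ∈ ({i} : Finset (Fin T))} → ℝ ↦ z ⟨i, by simp⟩ :=
    measurable_pi_apply _
  exact h.comp hφ measurable_id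

lemma infoGain_eq (hσ : 0 < σ) (hk : (Matrix.of k).PosSemidef) (T : ℕ) (a : ℕ → X) :
    infoGain k σ (fun i : Fin T ↦ a i) = ENNReal.ofReal (∑ i ∈ Finset.range T,
      Real.log (1 + postCov σ k i (fun j ↦ a j) (a i) (a i) / σ ^ 2) / 2) := by
  let P : Measure ((X → ℝ) × (Fin T → ℝ)) := (gpLaw k).prod (Measure.pi fun _ ↦ noiseLaw σ)
  -- Only `T` noises exist; later indices receive the dummy value 0.
  let ε : ℕ → (X → ℝ) × (Fin T → ℝ) → ℝ := fun i p ↦ if h : i < T then p.2 ⟨i, h⟩ else 0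
  let S : (X → ℝ) → Fin T → ℝ := fun r i ↦ r (a i)
  let b : ℕ → (Fin T → ℝ) → ℝ := fun i s ↦ if h : i < T then s ⟨i, h⟩ else 0
  have hS : Measurable S := by fun_prop
  have hb (i : ℕ) : Measurable (b i) := by
    simp only [b]; split_ifs <;> fun_prop
  have hεi (i : ℕ) (hi : i < T) : ε i = fun p ↦ p.2 ⟨i, hi⟩ := by
    ext p; simp [ε, hi]
  have hlaw (i : ℕ) (hi : i < T) : HasLaw (ε i) (noiseLaw σ) P := by
    rw [hεi i hi]
    exact ((measurePreserving_eval (fun _ : Fin T ↦ noiseLaw σ) ⟨i, hi⟩).comp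
      measurePreserving_snd).hasLaw
  have hind (i : ℕ) (hi : i < T) :
      IndepFun (ε i) (fun p ↦ (p.1, dataset Prod.fst ε (fun i _ ↦ a i) i p, a i)) P := by
    have h := indepFun_snd_of_indepFun (gpLaw k) (Measure.pi fun _ : Fin T ↦ noiseLaw σ)
      (measurable_pi_apply _) (by fun_prop) (indepFun_eval_pi (noiseLaw σ) ⟨i, hi⟩)
    rw [hεi i hi]
    let ψ : (X → ℝ) × ({j : Fin T // j ∈ Finset.univ.filter (· < (⟨i, hi⟩ : Fin T))} → ℝ) →
        (X → ℝ) × (Fin i → X × ℝ) × X :=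
      fun q ↦ (q.1, fun j ↦ (a j, q.1 (a j) + q.2 ⟨⟨j, j.2.trans hi⟩, by simp⟩), a i)
    have hψ : Measurable ψ := by fun_prop
    have e : (fun p ↦ (p.1, dataset Prod.fst ε (fun i _ ↦ a i) i p, a i)) =
        ψ ∘ fun p : (X → ℝ) × (Fin T → ℝ) ↦ (p.1, fun j ↦ p.2 j) := by
      ext1 p
      refine Prod.ext rfl (Prod.ext (funext fun j ↦ ?_) rfl)
      simp only [dataset, observation, hεi j (j.2.trans hi), ψ, Function.comp_apply]
    rw [e]
    exact h.comp (φ := id) measurable_id hψ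
  have hmain := mutualInfo_dataset (P := P) hσ hk measurePreserving_fst.hasLaw a hS T hb
    (fun i hi r ↦ by simp [b, S, hi]) hlaw hind
  rw [← hmain]
  -- Attaching the fixed query points to the observations is an injective recoding, which leaves the
  -- mutual information unchanged.
  let g : (Fin T → ℝ) → Fin T → X × ℝ := fun y i ↦ (a i, y i)
  let y : (X → ℝ) × (Fin T → ℝ) → Fin T → ℝ := fun p i ↦ p.1 (a i) + p.2 i
  have hy : Measurable y := by fun_prop
  have hg : Measurable g := by fun_prop
  have hd : dataset Prod.fst ε (fun i _ ↦ a i) T = g ∘ y := by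
    ext1 p
    ext1 i
    simp only [dataset, observation, hεi i i.2, g, y, Function.comp_apply]
  have h1 : P.map (fun p ↦ ((g ∘ y) p, S p.1)) =
      (P.map fun p ↦ (y p, S p.1)).map (Prod.map g id) := by
    rw [Measure.map_map (by fun_prop) (by fun_prop)]; rfl
  have : IsProbabilityMeasure (P.map y) := Measure.isProbabilityMeasure_map hy.aemeasurable
  have hSm : Measurable fun p : (X → ℝ) × (Fin T → ℝ) ↦ S p.1 := by fun_prop
  have : IsProbabilityMeasure (P.map fun p ↦ S p.1) :=
    Measure.isProbabilityMeasure_map hSm.aemeasurable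
  have h2 : (P.map (g ∘ y)).prod (P.map fun p ↦ S p.1) =
      ((P.map y).prod (P.map fun p ↦ S p.1)).map (Prod.map g id) := by
    rw [← Measure.map_prod_map _ _ hg measurable_id, Measure.map_id, Measure.map_map hg hy]
  rw [hd, mutualInfo, h1, h2, klDiv_map_of_leftInverse (h := Prod.map (fun d i ↦ (d i).2) id) _ _
    (by fun_prop) (by fun_prop) fun q ↦ rfl]
  rfl

/-- Finiteness is needed because `maxInfoGain` passes through `toReal`, which would turn an infinite
supremum into 0. -/
lemma infoGain_ne_top (hσ : 0 < σ) (hk : (Matrix.of k).PosSemidef) [Nonempty X] (T : ℕ)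
    (a : Fin T → X) : infoGain k σ a ≠ ⊤ := by
  have h := infoGain_eq hσ hk T fun i ↦ if h : i < T then a ⟨i, h⟩ else Classical.arbitrary X
  have ha : (fun i : Fin T ↦ (if h : (i : ℕ) < T then a ⟨i, h⟩ else Classical.arbitrary X)) = a := by
    ext1 i; simp
  rw [ha] at h
  rw [h]
  exact ENNReal.ofReal_ne_top

/-- The information gain of any list of points bounds the maximum information gain from below. -/
lemma sum_log_le_maxInfoGain (hσ : 0 < σ) (hk : (Matrix.of k).PosSemidef) (T : ℕ) (a : ℕ → X) :
    ∑ i ∈ Finset.range T, Real.log (1 + postCov σ k i (fun j ↦ a j) (a i) (a i) / σ ^ 2) / 2 ≤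
      maxInfoGain k σ T := by
  have : Nonempty X := ⟨a 0⟩
  refine (ENNReal.ofReal_le_iff_le_toReal ?_).1 ?_
  · obtain ⟨c, hc⟩ := exists_eq_ciSup_of_finite (f := fun a : Fin T → X ↦ infoGain k σ a)
    rw [← hc]
    exact infoGain_ne_top hσ hk T c
  · rw [← infoGain_eq hσ hk]
    exact le_iSup (fun a : Fin T → X ↦ infoGain k σ a) _

/-- As a function of `s`, the right side is concave and vanishes at 0, so on `[0, 1]` it lies above
its chord, which is the left side. -/
lemma le_log_div_log {σ s : ℝ} (hσ : 0 < σ) (hs0 : 0 ≤ s) (hs1 : s ≤ 1) :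
    s * Real.log (1 + σ ^ (-2 : ℤ)) ≤ Real.log (1 + s / σ ^ 2) := by
  have e : σ ^ (-2 : ℤ) = (σ ^ 2)⁻¹ := by rw [zpow_neg]; norm_cast
  rw [e]
  have h := strictConcaveOn_log_Ioi.concaveOn.2 (x := 1 + (σ ^ 2)⁻¹) (y := 1)
    (Set.mem_Ioi.2 (by positivity)) (Set.mem_Ioi.2 one_pos) hs0 (sub_nonneg.2 hs1) (by ring)
  simp only [smul_eq_mul, Real.log_one, mul_zero, add_zero] at h
  refine h.trans_eq ?_
  congr 1
  rw [div_eq_mul_inv]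
  ring

/-- The posterior variances at the queries are controlled by the maximum information gain, whatever
the observations made before. -/
lemma sum_postCov_le (hσ : 0 < σ) (hk : (Matrix.of k).PosSemidef) (hk1 : ∀ x, k x x = 1)
    (m T : ℕ) (a : ℕ → X) :
    ∑ t ∈ Finset.range T, postCov σ k (m + t) (fun j ↦ a j) (a (m + t)) (a (m + t)) ≤
      2 / Real.log (1 + σ ^ (-2 : ℤ)) * maxInfoGain k σ T := by
  have hL : 0 < Real.log (1 + σ ^ (-2 : ℤ)) :=
    Real.log_pos (by have : 0 < σ ^ (-2 : ℤ) := by positivity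
                     linarith)
  rw [div_mul_eq_mul_div, le_div_iff₀ hL, Finset.sum_mul]
  have h := sum_log_le_maxInfoGain hσ hk T fun i ↦ a (m + i)
  rw [← Finset.sum_div, div_le_iff₀ two_pos, mul_comm] at h
  refine (Finset.sum_le_sum fun t _ ↦ ?_).trans h
  have h0 := diag_nonneg (postCov_posSemidef hσ hk (m + t) fun j ↦ a j) (a (m + t))
  have h1 := postCov_diag_le hσ hk (m + t) (fun j ↦ a j) (a (m + t))
  rw [hk1] at h1
  refine (le_log_div_log hσ h0 h1).trans (Real.log_le_log (by positivity) ?_)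
  -- Forgetting the first `m` observations increases the variance, hence the logarithm, and gives
  -- the information terms of a list of `T` points.
  have := diag_le_of_quadForm_le (postCov_add_le hσ hk m a t) (a (m + t))
  gcongr

end MaximumInformationGain

/-! ### Moments of the posterior residual at a random point -/

section PosteriorMoments

variable {X : Type*} [Fintype X] {Ω : Type*} [MeasurableSpace Ω] {P : Measure Ω}
  {σ : ℝ} {k : X → X → ℝ}

lemma abs_le_sum_abs (r : X → ℝ) (z : X) : |r z| ≤ ∑ z, |r z| :=
  Finset.single_le_sum (f := fun z ↦ |r z|) (fun _ _ ↦ abs_nonneg _) (Finset.mem_univ z)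

lemma integrable_sum_abs {U : Ω → X → ℝ} (hi : ∀ z, Integrable (fun ω ↦ U ω z) P) :
    Integrable (fun ω ↦ ∑ z, |U ω z|) P :=
  integrable_finsetSum _ fun z _ ↦ (hi z).abs

lemma integrable_iSup [Nonempty X] {U : Ω → X → ℝ} (hU : AEMeasurable U P)
    (hi : ∀ z, Integrable (fun ω ↦ U ω z) P) : Integrable (fun ω ↦ ⨆ z, U ω z) P := by
  have hm : Measurable fun r : X → ℝ ↦ ⨆ z, r z := Measurable.iSup measurable_pi_apply
  refine (integrable_sum_abs hi).mono' (hm.comp_aemeasurable hU).aestronglyMeasurable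
    (.of_forall fun ω ↦ ?_)
  obtain ⟨z, hz⟩ := exists_eq_ciSup_of_finite (f := fun z ↦ U ω z)
  rw [← hz]
  exact abs_le_sum_abs _ z

lemma HasLaw.integrable_eval {U : Ω → X → ℝ} (hk : (Matrix.of k).PosSemidef)
    (hU : HasLaw U (gpLaw k) P) (z : X) : Integrable (fun ω ↦ U ω z) P := by
  have h : Integrable id (gaussianReal 0 (k z z).toNNReal) :=
    (memLp_id_gaussianReal 1).integrable le_rfl
  rw [← map_eval_gpLaw hk z, ← hU.map_eq,
    AEMeasurable.map_map_of_aemeasurable (measurable_pi_apply z).aemeasurable hU.aemeasurable] at h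
  exact h.comp_aemeasurable ((measurable_pi_apply z).comp_aemeasurable hU.aemeasurable)

/-- The bound can fail on a null set only: where the variance is 0 the score is 0 by convention, but
the coordinate itself vanishes almost surely. -/
lemma ae_gpLaw_le_maxScore_mul {C : X → X → ℝ} (hC : (Matrix.of C).PosSemidef) :
    ∀ᵐ r ∂gpLaw C, ∀ z, r z ≤ maxScore C r * √(C z z) := by
  rw [ae_all_iff]
  intro z
  rcases (diag_nonneg hC z).eq_or_lt with h0 | h0
  · have h := map_eval_gpLaw hC z
    rw [← h0, Real.toNNReal_zero, gaussianReal_zero_var] at h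
    have hz : ∀ᵐ r ∂gpLaw C, r z = 0 := by
      have : ∀ᵐ y ∂(gpLaw C).map (fun r ↦ r z), y = 0 := by rw [h]; simp
      exact ae_of_ae_map (measurable_pi_apply z).aemeasurable this
    filter_upwards [hz] with r hr
    rw [hr, ← h0, Real.sqrt_zero, mul_zero]
  · exact .of_forall fun r ↦ (div_le_iff₀ (Real.sqrt_pos.2 h0)).1 (le_maxScore C r z)

variable [MeasurableSpace X] [MeasurableSingletonClass X]

lemma aemeasurable_eval_point {U : Ω → X → ℝ} {a : Ω → X} (hU : AEMeasurable U P)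
    (ha : AEMeasurable a P) : AEMeasurable (fun ω ↦ U ω (a ω)) P :=
  (measurable_eval_point measurable_fst measurable_snd).comp_aemeasurable (hU.prodMk ha)

lemma integrable_eval_point {U : Ω → X → ℝ} {a : Ω → X} (hU : AEMeasurable U P)
    (hi : ∀ z, Integrable (fun ω ↦ U ω z) P) (ha : AEMeasurable a P) :
    Integrable (fun ω ↦ U ω (a ω)) P :=
  (integrable_sum_abs hi).mono' (aemeasurable_eval_point hU ha).aestronglyMeasurable
    (.of_forall fun _ ↦ abs_le_sum_abs _ _)

variable [IsProbabilityMeasure P]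

variable {n : ℕ} {U : Ω → X → ℝ} {Z : Ω → Fin n → X × ℝ}

lemma integrable_sq_of_hasCondDistrib (hσ : 0 < σ) (hk : (Matrix.of k).PosSemidef)
    (hU : HasCondDistrib U Z (residualKernel σ k n) P) (z : X) :
    Integrable (fun ω ↦ U ω z ^ 2) P := by
  have hUm := hU.aemeasurable_snd
  have hUz : AEMeasurable (fun ω ↦ U ω z) P := (measurable_pi_apply z).comp_aemeasurable hUm
  have hZm := hU.aemeasurable_fst
  have : IsProbabilityMeasure (P.map Z) := Measure.isProbabilityMeasure_map hZm
  rw [← lintegral_ofReal_ne_top_iff_integrable (by fun_prop) (.of_forall fun ω ↦ sq_nonneg _)]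
  have hm : Measurable fun p : (Fin n → X × ℝ) × (X → ℝ) ↦ ENNReal.ofReal (p.2 z ^ 2) := by
    fun_prop
  rw [hU.lintegral_comp (f := fun p ↦ ENNReal.ofReal (p.2 z ^ 2)) hm.aemeasurable,
    Measure.lintegral_compProd hm]
  refine ((lintegral_mono (g := fun _ ↦ ENNReal.ofReal (k z z)) fun d ↦ ?_).trans_lt ?_).ne
  · have hC := postCov_posSemidef hσ hk n (queries n d)
    have h : ∫⁻ r, ENNReal.ofReal (r z ^ 2) ∂gpLaw (postCov σ k n (queries n d)) =
        ENNReal.ofReal (postCov σ k n (queries n d) z z) := by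
      rw [← lintegral_map (f := fun y ↦ ENNReal.ofReal (y ^ 2)) (g := fun r : X → ℝ ↦ r z)
        (by fun_prop) (by fun_prop), map_eval_gpLaw hC, ← ofReal_integral_eq_lintegral_ofReal
        (integrable_sq_gaussianReal _) (.of_forall fun _ ↦ sq_nonneg _), integral_sq_gaussianReal,
        Real.coe_toNNReal _ (diag_nonneg hC z)]
    rw [residualKernel_apply]
    exact h.trans_le (ENNReal.ofReal_le_ofReal (postCov_diag_le hσ hk n _ z))
  · simp

lemma integrable_of_hasCondDistrib (hσ : 0 < σ) (hk : (Matrix.of k).PosSemidef)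
    (hU : HasCondDistrib U Z (residualKernel σ k n) P) (z : X) :
    Integrable (fun ω ↦ U ω z) P := by
  have hUz : AEMeasurable (fun ω ↦ U ω z) P :=
    (measurable_pi_apply z).comp_aemeasurable hU.aemeasurable_snd
  exact ((memLp_two_iff_integrable_sq hUz.aestronglyMeasurable).2
    (integrable_sq_of_hasCondDistrib hσ hk hU z)).integrable one_le_two

lemma measurable_maxScore_postCov (σ : ℝ) (k : X → X → ℝ) (n : ℕ) :
    Measurable fun p : (Fin n → X × ℝ) × (X → ℝ) ↦
      maxScore (postCov σ k n (queries n p.1)) p.2 := by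
  have h : Measurable fun p : (Fin n → X) × (X → ℝ) ↦ maxScore (postCov σ k n p.1) p.2 :=
    measurable_from_prod_countable_right fun a ↦ measurable_maxScore (postCov σ k n a)
  exact h.comp (((measurable_queries n).comp measurable_fst).prodMk measurable_snd)

lemma ae_le_maxScore_mul (hσ : 0 < σ) (hk : (Matrix.of k).PosSemidef)
    (hU : HasCondDistrib U Z (residualKernel σ k n) P) :
    ∀ᵐ ω ∂P, ∀ z, U ω z ≤ maxScore (postCov σ k n (queries n (Z ω))) (U ω) *
      √(postCov σ k n (queries n (Z ω)) z z) := by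
  have hZm := hU.aemeasurable_fst
  have : IsProbabilityMeasure (P.map Z) := Measure.isProbabilityMeasure_map hZm
  have hm : MeasurableSet {p : (Fin n → X × ℝ) × (X → ℝ) | ∀ z, p.2 z ≤
      maxScore (postCov σ k n (queries n p.1)) p.2 * √(postCov σ k n (queries n p.1) z z)} := by
    rw [measurableSet_setOfPred]
    refine Measurable.forall fun z ↦ ?_
    rw [← measurableSet_setOfPred]
    have hc : Measurable fun a : Fin n → X ↦ √(postCov σ k n a z z) := .of_discrete
    exact measurableSet_le (by fun_prop) ((measurable_maxScore_postCov σ k n).mul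
      (hc.comp ((measurable_queries n).comp measurable_fst)))
  refine (HasLaw.ae_iff hU (measurableSet_setOfPred.1 hm)).2 ?_
  refine Measure.ae_compProd_of_ae_ae hm (.of_forall fun d ↦ ?_)
  exact ae_gpLaw_le_maxScore_mul (postCov_posSemidef hσ hk n (queries n d))

lemma lintegral_maxScore_postCov_le (hX : 2 ≤ Fintype.card X) (hσ : 0 < σ)
    (hk : (Matrix.of k).PosSemidef) (hU : HasCondDistrib U Z (residualKernel σ k n) P) :
    ∫⁻ ω, ENNReal.ofReal (maxScore (postCov σ k n (queries n (Z ω))) (U ω) ^ 2) ∂P ≤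
      ENNReal.ofReal (2 + 2 * Real.log ((Fintype.card X : ℝ) / 2)) := by
  have hZm := hU.aemeasurable_fst
  have : IsProbabilityMeasure (P.map Z) := Measure.isProbabilityMeasure_map hZm
  have hm : Measurable fun p : (Fin n → X × ℝ) × (X → ℝ) ↦
      ENNReal.ofReal (maxScore (postCov σ k n (queries n p.1)) p.2 ^ 2) :=
    ((measurable_maxScore_postCov σ k n).pow_const 2).ennreal_ofReal
  rw [hU.lintegral_comp (f := fun p ↦ ENNReal.ofReal (maxScore (postCov σ k n (queries n p.1))
    p.2 ^ 2)) hm.aemeasurable, Measure.lintegral_compProd hm]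
  refine (lintegral_mono fun d ↦ lintegral_maxScore_sq_le hX
    (postCov_posSemidef hσ hk n (queries n d))).trans ?_
  simp

lemma integrable_postCov_query (hσ : 0 < σ) (hk : (Matrix.of k).PosSemidef)
    (hZ : AEMeasurable Z P) {a : Ω → X} (ha : AEMeasurable a P) :
    Integrable (fun ω ↦ postCov σ k n (queries n (Z ω)) (a ω) (a ω)) P := by
  have hc : Measurable fun q : (Fin n → X) × X ↦ postCov σ k n q.1 q.2 q.2 := .of_discrete
  have hm : AEMeasurable (fun ω ↦ postCov σ k n (queries n (Z ω)) (a ω) (a ω)) P :=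
    hc.comp_aemeasurable (((measurable_queries n).comp_aemeasurable hZ).prodMk ha)
  refine (integrable_const (∑ z, |k z z|)).mono' hm.aestronglyMeasurable (.of_forall fun ω ↦ ?_)
  rw [Real.norm_of_nonneg (diag_nonneg (postCov_posSemidef hσ hk n _) _)]
  exact (postCov_diag_le hσ hk n _ _).trans
    ((le_abs_self _).trans (abs_le_sum_abs (fun z ↦ k z z) _))

/-- The mean of a posterior residual at a random point is controlled by the mean of the posterior
variance at this point. -/
lemma integral_eval_le_sqrt (hX : 2 ≤ Fintype.card X) (hσ : 0 < σ)
    (hk : (Matrix.of k).PosSemidef) (hU : HasCondDistrib U Z (residualKernel σ k n) P)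
    {a : Ω → X} (ha : AEMeasurable a P) :
    ∫ ω, U ω (a ω) ∂P ≤ √((2 + 2 * Real.log ((Fintype.card X : ℝ) / 2)) *
      ∫ ω, postCov σ k n (queries n (Z ω)) (a ω) (a ω) ∂P) := by
  have hUm := hU.aemeasurable_snd
  have hZm := hU.aemeasurable_fst
  set M : Ω → ℝ := fun ω ↦ maxScore (postCov σ k n (queries n (Z ω))) (U ω) with hM
  set c : Ω → ℝ := fun ω ↦ postCov σ k n (queries n (Z ω)) (a ω) (a ω) with hc
  have hMm : AEMeasurable M P :=
    (measurable_maxScore_postCov σ k n).comp_aemeasurable (hZm.prodMk hUm)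
  have hci : Integrable c P := integrable_postCov_query hσ hk hZm ha
  have hc0 (ω : Ω) : 0 ≤ c ω := diag_nonneg (postCov_posSemidef hσ hk n _) _
  have hM2 := lintegral_maxScore_postCov_le hX hσ hk hU
  have hMi : Integrable (fun ω ↦ M ω ^ 2) P :=
    (lintegral_ofReal_ne_top_iff_integrable (by fun_prop) (.of_forall fun ω ↦ sq_nonneg _)).1
      (hM2.trans_lt ENNReal.ofReal_lt_top).ne
  have hK : 0 ≤ 2 + 2 * Real.log ((Fintype.card X : ℝ) / 2) := by
    have : (2 : ℝ) ≤ Fintype.card X := by exact_mod_cast hX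
    have := Real.log_nonneg (show 1 ≤ (Fintype.card X : ℝ) / 2 by linarith)
    positivity
  have hMK : ∫ ω, M ω ^ 2 ∂P ≤ 2 + 2 * Real.log ((Fintype.card X : ℝ) / 2) := by
    rw [← ENNReal.ofReal_le_ofReal_iff hK,
      ofReal_integral_eq_lintegral_ofReal hMi (.of_forall fun ω ↦ sq_nonneg _)]
    exact hM2
  have hML : MemLp M 2 P := (memLp_two_iff_integrable_sq hMm.aestronglyMeasurable).2 hMi
  have hsm : AEStronglyMeasurable (fun ω ↦ √(c ω)) P :=
    (Real.continuous_sqrt.measurable.comp_aemeasurable hci.aemeasurable).aestronglyMeasurable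
  have hsL : MemLp (fun ω ↦ √(c ω)) 2 P :=
    (memLp_two_iff_integrable_sq hsm).2 (by simpa only [Real.sq_sqrt (hc0 _)] using hci)
  have hprod : Integrable (fun ω ↦ M ω * √(c ω)) P := hML.integrable_mul hsL
  calc ∫ ω, U ω (a ω) ∂P ≤ ∫ ω, M ω * √(c ω) ∂P := by
        refine integral_mono_ae
          (integrable_eval_point hUm (integrable_of_hasCondDistrib hσ hk hU) ha) hprod ?_
        -- The bound holds at all points simultaneously, so `a` may depend on `U`.
        filter_upwards [ae_le_maxScore_mul hσ hk hU] with ω hω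
        exact hω (a ω)
    _ ≤ (∫ ω, M ω ^ (2 : ℝ) ∂P) ^ (1 / (2 : ℝ)) * (∫ ω, √(c ω) ^ (2 : ℝ) ∂P) ^ (1 / (2 : ℝ)) :=
        integral_mul_le_Lp_mul_Lq_of_nonneg Real.HolderConjugate.two_two
          (.of_forall fun ω ↦ maxScore_nonneg _ _) (.of_forall fun ω ↦ Real.sqrt_nonneg _)
          (by simpa using hML) (by simpa using hsL)
    _ = √((∫ ω, M ω ^ 2 ∂P) * ∫ ω, c ω ∂P) := by
        simp only [Real.rpow_two, Real.sq_sqrt (hc0 _), ← Real.sqrt_eq_rpow]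
        rw [Real.sqrt_mul (integral_nonneg fun ω ↦ sq_nonneg _)]
    _ ≤ _ := Real.sqrt_le_sqrt (mul_le_mul_of_nonneg_right hMK (integral_nonneg hc0))

end PosteriorMoments

/-! ### Regret of one round and summation over the rounds -/

section Regret

variable {X : Type*} [Fintype X] [MeasurableSpace X]
  {Ω : Type*} [MeasurableSpace Ω] {P : Measure Ω} [IsProbabilityMeasure P]
  {σ : ℝ} {k : X → X → ℝ} {n₀ : ℕ} {f : Ω → X → ℝ} {ε : ℕ → Ω → ℝ} {g : ℕ → Ω → X → ℝ}
  {x : ℕ → Ω → X}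

lemma IsThompsonSampling.drawnFrom (h : IsThompsonSampling k σ n₀ P f ε g x) (n : ℕ) :
    DrawnFrom (x n) (dataset f ε x n) f P := by
  rcases lt_or_ge n n₀ with hn | hn
  · exact h.initial n hn
  · exact (h.sample n hn).drawnFrom_of_drawnFrom (h.query_rule n hn)

/-- The sample path and the objective have the same joint law with the data. -/
lemma IsThompsonSampling.map_dataset_sample (h : IsThompsonSampling k σ n₀ P f ε g x) {n : ℕ}
    (hn : n₀ ≤ n) :
    P.map (fun ω ↦ (dataset f ε x n ω, g n ω)) = P.map (fun ω ↦ (dataset f ε x n ω, f ω)) := by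
  rw [(h.sample n hn).hasCondDistrib.map_eq, compProd_map_condDistrib h.objective.aemeasurable]

lemma IsThompsonSampling.aemeasurable_query (h : IsThompsonSampling k σ n₀ P f ε g x) (n : ℕ) :
    AEMeasurable (x n) P := by
  obtain ⟨κ, _, hx⟩ := h.drawnFrom n
  exact HasCondDistrib.aemeasurable_snd hx

variable [MeasurableSingletonClass X]

/-- Given the data and the query, the residual is still centred Gaussian. Thus the objective and its
posterior mean agree on average at the query. -/
lemma integral_residual_query_eq_zero (hσ : 0 < σ) (hk : (Matrix.of k).PosSemidef) {n : ℕ}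
    (hR : HasCondDistrib (residual σ k f ε x n) (dataset f ε x n) (residualKernel σ k n) P)
    (hx : DrawnFrom (x n) (dataset f ε x n) f P) :
    ∫ ω, residual σ k f ε x n ω (x n ω) ∂P = 0 := by
  have hRx := hasCondDistrib_residual_query hR hx
  have hxm : AEMeasurable (x n) P := hRx.aemeasurable_fst.snd
  have hm : Measurable fun p : ((Fin n → X × ℝ) × X) × (X → ℝ) ↦ p.2 p.1.2 :=
    measurable_eval_point (by fun_prop) (by fun_prop)
  have : IsProbabilityMeasure (P.map fun ω ↦ (dataset f ε x n ω, x n ω)) :=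
    Measure.isProbabilityMeasure_map hRx.aemeasurable_fst
  have hi : Integrable (fun ω ↦ residual σ k f ε x n ω (x n ω)) P :=
    integrable_eval_point hR.aemeasurable_snd (integrable_of_hasCondDistrib hσ hk hR) hxm
  have h1 := hRx.integral_comp (f := fun p ↦ p.2 p.1.2) hm.aestronglyMeasurable
  have h2 : Integrable (fun p : ((Fin n → X × ℝ) × X) × (X → ℝ) ↦ p.2 p.1.2)
      (P.map (fun ω ↦ (dataset f ε x n ω, x n ω)) ⊗ₘ
        Kernel.prodMkRight X (residualKernel σ k n)) := by
    rw [← hRx.map_eq, integrable_map_measure hm.aestronglyMeasurable hRx.aemeasurable]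
    exact hi
  refine h1.trans ?_
  rw [Measure.integral_compProd h2]
  refine integral_eq_zero_of_ae (.of_forall fun q ↦ ?_)
  have hC := postCov_posSemidef hσ hk n (queries n q.1)
  change ∫ r, r q.2 ∂gpLaw (postCov σ k n (queries n q.1)) = 0
  have h3 := integral_map (μ := gpLaw (postCov σ k n (queries n q.1)))
    (φ := fun r ↦ r q.2) (f := fun y : ℝ ↦ y) (measurable_pi_apply _).aemeasurable (by fun_prop)
  rw [map_eval_gpLaw hC, integral_id_gaussianReal] at h3
  exact h3.symm

lemma IsThompsonSampling.hasCondDistrib_residual (h : IsThompsonSampling k σ n₀ P f ε g x)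
    (hσ : 0 < σ) (hk : (Matrix.of k).PosSemidef) (n : ℕ) :
    HasCondDistrib (residual σ k f ε x n) (dataset f ε x n) (residualKernel σ k n) P :=
  BayesOpt.hasCondDistrib_residual hσ hk h.objective n (fun i _ ↦ h.noise_law i)
    (fun i _ ↦ h.noise_indep i) fun i _ ↦ h.drawnFrom i

lemma IsThompsonSampling.integrable_regret [Nonempty X]
    (h : IsThompsonSampling k σ n₀ P f ε g x) (hk : (Matrix.of k).PosSemidef) (n : ℕ) :
    Integrable (fun ω ↦ (⨆ z, f ω z) - f ω (x n ω)) P :=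
  have hf := h.objective
  have hfi := HasLaw.integrable_eval hk hf
  (integrable_iSup hf.aemeasurable hfi).sub
    (integrable_eval_point hf.aemeasurable hfi (h.aemeasurable_query n))

/-- The Bayesian regret of one round. -/
lemma IsThompsonSampling.integral_regret_le (h : IsThompsonSampling k σ n₀ P f ε g x)
    (hX : 2 ≤ Fintype.card X) (hσ : 0 < σ) (hk : (Matrix.of k).PosSemidef) {n : ℕ} (hn : n₀ ≤ n) :
    ∫ ω, ((⨆ z, f ω z) - f ω (x n ω)) ∂P ≤
      √((2 + 2 * Real.log ((Fintype.card X : ℝ) / 2)) *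
        ∫ ω, postCov σ k n (fun j ↦ x j ω) (x n ω) (x n ω) ∂P) := by
  have : Nonempty X := Fintype.card_pos_iff.1 (by omega)
  have hf := h.objective
  have hfi := HasLaw.integrable_eval hk hf
  have hR := h.hasCondDistrib_residual hσ hk n
  have hRi := integrable_of_hasCondDistrib hσ hk hR
  have hxm := h.aemeasurable_query n
  have hDm := hR.aemeasurable_fst
  have hfm := hf.aemeasurable
  have hgm : AEMeasurable (g n) P := HasCondDistrib.aemeasurable_snd (h.sample n hn)
  have hmap := h.map_dataset_sample hn
  have hg : HasLaw (g n) (gpLaw k) P := by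
    refine ⟨hgm, ?_⟩
    have h1 := congrArg (Measure.map Prod.snd) hmap
    rw [AEMeasurable.map_map_of_aemeasurable (by fun_prop) (by fun_prop),
      AEMeasurable.map_map_of_aemeasurable (by fun_prop) (by fun_prop)] at h1
    exact h1.trans hf.map_eq
  have hgi := HasLaw.integrable_eval hk hg
  have hμ := measurable_postMean σ k n
  -- `g n` and `f` have the same joint law with the data, and `postMean` is a function of the data;
  -- hence `g n` minus the posterior mean has the conditional law of the residual.
  have hG : HasCondDistrib (fun ω ↦ g n ω - postMean σ k n (dataset f ε x n ω)) (dataset f ε x n)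
      (residualKernel σ k n) P := by
    refine ⟨by fun_prop, ?_⟩
    have h1 := congrArg (Measure.map fun p : (Fin n → X × ℝ) × (X → ℝ) ↦
      (p.1, p.2 - postMean σ k n p.1)) hmap
    rw [AEMeasurable.map_map_of_aemeasurable (by fun_prop) (by fun_prop),
      AEMeasurable.map_map_of_aemeasurable (by fun_prop) (by fun_prop)] at h1
    exact h1.trans hR.map_eq
  have hsup : ∫ ω, (⨆ z, f ω z) ∂P = ∫ ω, g n ω (x n ω) ∂P := by
    have hm : Measurable fun r : X → ℝ ↦ ⨆ z, r z := Measurable.iSup measurable_pi_apply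
    have h1 := hf.integral_comp (f := fun r ↦ ⨆ z, r z) hm.aestronglyMeasurable
    have h2 := hg.integral_comp (f := fun r ↦ ⨆ z, r z) hm.aestronglyMeasurable
    refine (h1.trans h2.symm).trans (integral_congr_ae ?_)
    filter_upwards [h.query_max n hn] with ω hω
    exact le_antisymm (ciSup_le hω) (le_ciSup (f := fun z ↦ g n ω z)
      (Set.finite_range _).bddAbove (x n ω))
  have hfx := integrable_eval_point hfm hfi hxm
  have hRx := integrable_eval_point hR.aemeasurable_snd hRi hxm
  have hgx := integrable_eval_point hgm hgi hxm
  have hR0 := integral_residual_query_eq_zero hσ hk hR (h.drawnFrom n)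
  have hmean : ∫ ω, postMean σ k n (dataset f ε x n ω) (x n ω) ∂P = ∫ ω, f ω (x n ω) ∂P := by
    have h1 := integral_sub hfx hRx
    rw [hR0, sub_zero] at h1
    rw [← h1]
    refine integral_congr_ae (.of_forall fun ω ↦ ?_)
    simp [residual]
  have hmi : Integrable (fun ω ↦ postMean σ k n (dataset f ε x n ω) (x n ω)) P := by
    refine (hfx.sub hRx).congr (.of_forall fun ω ↦ ?_)
    simp [residual]
  -- The moment bound is applied to the residual of `g n`, not of `f`: the query depends on `g n`,
  -- so this mean need not vanish.
  have hfinal := integral_eval_le_sqrt hX hσ hk hG hxm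
  simp only [Pi.sub_apply] at hfinal
  rw [integral_sub hgx hmi, hmean, ← hsup] at hfinal
  rw [integral_sub (integrable_iSup hfm hfi) hfx]
  exact hfinal

lemma IsThompsonSampling.bayesCumulativeRegret_le [Nonempty X]
    (h : IsThompsonSampling k σ n₀ P f ε g x) (hσ : 0 < σ) (hk : (Matrix.of k).PosSemidef)
    (hk1 : ∀ x, k x x = 1) (T : ℕ) :
    bayesCumulativeRegret P f x n₀ T ≤
      √(2 / Real.log (1 + σ ^ (-2 : ℤ)) * (2 + 2 * Real.log ((Fintype.card X : ℝ) / 2)) * T *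
        maxInfoGain k σ T) := by
  unfold bayesCumulativeRegret cumulativeRegret
  rw [integral_finsetSum _ fun t _ ↦ h.integrable_regret hk (n₀ + t)]
  -- With a single point the regret is zero; the moment bound requires two.
  rcases lt_or_ge (Fintype.card X) 2 with hX | hX
  · have : Subsingleton X := Fintype.card_le_one_iff_subsingleton.1 (by omega)
    refine le_trans (le_of_eq ?_) (Real.sqrt_nonneg _)
    refine Finset.sum_eq_zero fun t _ ↦ ?_
    refine integral_eq_zero_of_ae (.of_forall fun ω ↦ ?_)
    change (⨆ z, f ω z) - f ω (x (n₀ + t) ω) = 0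
    rw [ciSup_subsingleton (x (n₀ + t) ω), sub_self]
  set K := 2 + 2 * Real.log ((Fintype.card X : ℝ) / 2) with hK
  have hK0 : 0 ≤ K := by
    have : (2 : ℝ) ≤ Fintype.card X := by exact_mod_cast hX
    have := Real.log_nonneg (show 1 ≤ (Fintype.card X : ℝ) / 2 by linarith)
    positivity
  set c : ℕ → Ω → ℝ := fun t ω ↦
    postCov σ k (n₀ + t) (fun j ↦ x j ω) (x (n₀ + t) ω) (x (n₀ + t) ω) with hc
  have hc0 (t : ℕ) (ω : Ω) : 0 ≤ c t ω := diag_nonneg (postCov_posSemidef hσ hk _ _) _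
  have hci (t : ℕ) : Integrable (c t) P :=
    integrable_postCov_query hσ hk (h.hasCondDistrib_residual hσ hk (n₀ + t)).aemeasurable_fst
      (h.aemeasurable_query (n₀ + t))
  have hsum : ∑ t ∈ Finset.range T, ∫ ω, c t ω ∂P ≤
      2 / Real.log (1 + σ ^ (-2 : ℤ)) * maxInfoGain k σ T := by
    rw [← integral_finsetSum _ fun t _ ↦ hci t]
    -- The variance bound holds for every sequence of points, hence pathwise for the random queries,
    -- before expectations are taken.
    refine (integral_mono (integrable_finsetSum _ fun t _ ↦ hci t) (integrable_const _)
      fun ω ↦ sum_postCov_le hσ hk hk1 n₀ T fun j ↦ x j ω).trans_eq ?_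
    simp
  calc ∑ t ∈ Finset.range T, ∫ ω, ((⨆ z, f ω z) - f ω (x (n₀ + t) ω)) ∂P
      ≤ ∑ t ∈ Finset.range T, √K * √(∫ ω, c t ω ∂P) := by
        refine Finset.sum_le_sum fun t _ ↦ ?_
        rw [← Real.sqrt_mul hK0]
        exact h.integral_regret_le hX hσ hk (Nat.le_add_right n₀ t)
    _ ≤ √(∑ _t ∈ Finset.range T, K) * √(∑ t ∈ Finset.range T, ∫ ω, c t ω ∂P) :=
        Real.sum_sqrt_mul_sqrt_le _ (fun _ ↦ hK0) fun t ↦ integral_nonneg (hc0 t)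
    _ = √(T * K * ∑ t ∈ Finset.range T, ∫ ω, c t ω ∂P) := by
        rw [Finset.sum_const, Finset.card_range, nsmul_eq_mul, ← Real.sqrt_mul (by positivity)]
    _ ≤ √(T * K * (2 / Real.log (1 + σ ^ (-2 : ℤ)) * maxInfoGain k σ T)) := by gcongr
    _ = _ := by congr 1; ring

end Regret

end BayesOpt

theorem mainTheorem1 {d : ℕ} (D : Finset (EuclideanSpace ℝ (Fin d))) (hD : D.Nonempty)
    (k : D → D → ℝ) (hk_psd : (Matrix.of k).PosSemidef) (hk_stat : BayesOpt.IsStationary k)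
    (hk_one : ∀ x, k x x = 1) (σ : ℝ) (hσ : 0 < σ) (n₀ : ℕ)
    {Ω : Type*} [MeasurableSpace Ω] (P : Measure Ω) [IsProbabilityMeasure P]
    (f : Ω → D → ℝ) (ε : ℕ → Ω → ℝ) (g : ℕ → Ω → D → ℝ) (x : ℕ → Ω → D)
    (hTS : BayesOpt.IsThompsonSampling k σ n₀ P f ε g x) (T : ℕ) :
    Integrable (BayesOpt.cumulativeRegret f x n₀ T) P ∧
      BayesOpt.bayesCumulativeRegret P f x n₀ T ≤
        Real.sqrt ((2 / Real.log (1 + σ ^ (-2 : ℤ))) * (2 + 2 * Real.log ((D.card : ℝ) / 2)) *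
          (T : ℝ) * BayesOpt.maxInfoGain k σ T) := by
  have : Nonempty D := hD.to_subtype
  refine ⟨integrable_finsetSum _ fun t _ ↦ hTS.integrable_regret hk_psd (n₀ + t), ?_⟩
  have h := hTS.bayesCumulativeRegret_le hσ hk_psd hk_one T
  rwa [Fintype.card_coe] at h
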